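/- Let $M$ be $\mathbb S^3$ with the round metric of curvature $K=1$, $\mathbb R^3$ with the flat metric ($K=0$), or $\mathbb H^3$ with the metric of curvature $K=-1$. Let $I\subset\mathbb R$ be an interval with non-empty interior and $\gamma\colon I\to M$ a smooth curve parametrized by arclength. Call $\gamma$ a \emph{proper $\tfrac12$-biharmonic curve} if $\nabla_{\gamma'}\gamma'$ has no zeros on $I$, its geodesic curvature $k=|\nabla_{\gamma'}\gamma'|$ is not constant, and $\gamma$ is a critical point of $$E_{2,1/2}(\gamma)=2\int_I|\nabla_{\gamma'}\gamma'|^{1/2}\,ds$$ with respect to all smooth variations that leave $\gamma$ unchanged outside a compact interval contained in the interior of $I$. Every proper $\tfrac12$-biharmonic curve has a smooth Frenet frame $T=\gamma',N,B$, that is, an orthonormal frame along $\gamma$ with $$\nabla_{\gamma'}T=kN,\qquad \nabla_{\gamma'}N=-kT+\tau B,\qquad \nabla_{\gamma'}B=-\tau N,\qquad k>0 .$$ Moreover, if $\gamma$ has a smooth Frenet frame with geodesic curvature $k>0$ and torsion $\tau$, then: 1. If $M=\mathbb S^3$, then $\gamma$ is proper $\tfrac12$-biharmonic if and only if there are $b_1,b_2,b_3\in\mathbb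 R$ with $b_2^2>4+4b_1^2$ such that on $I$ $$k(s)=\frac{2}{b_2+\sqrt{b_2^2-4-4b_1^2}\,\sin 2(s+b_3)},\qquad \tau(s)=b_1k(s).$$ 2. If $M=\mathbb R^3$, then $\gamma$ is proper $\tfrac12$-biharmonic if and only if there are $b_1,b_4,b_5\in\mathbb R$ such that on $I$ $$k(s)=\frac{b_4}{b_4^2(s-b_5)^2+1+b_1^2},\qquad \tau(s)=b_1k(s).$$ 3. If $M=\mathbb H^3$, then $\gamma$ is proper $\tfrac12$-biharmonic if and only if there are $b_1,b_6,b_7\in\mathbb R$ such that on $I$ $$k(s)=\frac{4e^{-2(b_7+s)}}{\left(b_6+e^{-2(b_7+s)}\right)^2+4+4b_1^2},\qquad \tau(s)=b_1k(s).$$ -/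

import Mathlib

open scoped ContDiff

noncomputable section

/-- A simply connected space form presented inside a real vector space `V`: an ambient symmetric
bilinear form `form`, the sectional curvature `curv`, and the underlying set `carrier`. Only the three
instances `sphere3`, `euclidean3`, `hyperbolic3` below are used. -/
structure SpaceFormModel (V : Type*) [NormedAddCommGroup V] [NormedSpace ℝ V] where
  form : V →ₗ[ℝ] V →ₗ[ℝ] ℝ
  curv : ℝ
  carrier : Set V

/-- The Lorentz form `-x₀y₀ + x₁y₁ + x₂y₂ + x₃y₃` on `ℝ⁴`. -/
def lorentzForm : EuclideanSpace ℝ (Fin 4) →ₗ[ℝ] EuclideanSpace ℝ (Fin 4) →ₗ[ℝ] ℝ :=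
  LinearMap.mk₂ ℝ (fun x y => -(x 0 * y 0) + x 1 * y 1 + x 2 * y 2 + x 3 * y 3)
    (by intro x x' y; simp only [PiLp.add_apply]; ring)
    (by intro c x y; simp only [PiLp.smul_apply, smul_eq_mul]; ring)
    (by intro x y y'; simp only [PiLp.add_apply]; ring)
    (by intro c x y; simp only [PiLp.smul_apply, smul_eq_mul]; ring)

/-- The round unit sphere `S³ ⊂ ℝ⁴`, of curvature `1`. -/
def sphere3 : SpaceFormModel (EuclideanSpace ℝ (Fin 4)) where
  form := innerₗ (EuclideanSpace ℝ (Fin 4))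
  curv := 1
  carrier := Metric.sphere 0 1

/-- Flat Euclidean space `ℝ³`, of curvature `0`. -/
def euclidean3 : SpaceFormModel (EuclideanSpace ℝ (Fin 3)) where
  form := innerₗ (EuclideanSpace ℝ (Fin 3))
  curv := 0
  carrier := Set.univ

/-- Hyperbolic space `H³`, of curvature `-1`, as the upper sheet of the hyperboloid
`⟨x, x⟩ = -1` in Minkowski space, with the Riemannian metric induced by the Lorentz form. -/
def hyperbolic3 : SpaceFormModel (EuclideanSpace ℝ (Fin 4)) where
  form := lorentzForm
  curv := -1
  carrier := {x | lorentzForm x x = -1 ∧ 0 < x 0}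

namespace SpaceFormModel

variable {V : Type*} [NormedAddCommGroup V] [NormedSpace ℝ V]

/-- Orthogonal projection of the ambient space onto the tangent space at `x`. For `K = ±1` the point
`x` satisfies `⟨x, x⟩ = K` and the tangent space is `{v | ⟨v, x⟩ = 0}`; for `K = 0` the
tangent space is the whole ambient space. -/
def tangentProj (M : SpaceFormModel V) (x v : V) : V :=
  v - (M.curv * M.form v x) • x

/-- Riemannian length of a tangent vector. -/
def len (M : SpaceFormModel V) (v : V) : ℝ := Real.sqrt (M.form v v)

/-- Covariant derivative `∇_{γ'} X`, for the Levi-Civita connection, of a vector field `X` along a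
curve `γ` defined on `I`: the tangential part of the ambient derivative. -/
def covDeriv (M : SpaceFormModel V) (I : Set ℝ) (γ X : ℝ → V) (s : ℝ) : V :=
  M.tangentProj (γ s) (derivWithin X I s)

/-- Tension field `τ(γ) = ∇_{γ'} γ'`. -/
def tension (M : SpaceFormModel V) (I : Set ℝ) (γ : ℝ → V) : ℝ → V :=
  M.covDeriv I γ (derivWithin γ I)

/-- `(1/p) ∫_a^b |∇_{γ'} γ'|^p ds`. -/
def pBienergy (M : SpaceFormModel V) (p : ℝ) (I : Set ℝ) (a b : ℝ) (γ : ℝ → V) : ℝ :=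
  (1 / p) * ∫ s in a..b, (M.len (M.tension I γ s)) ^ p

/-- A smooth curve `γ : I → M` parametrized by arclength. -/
structure IsUnitSpeedCurve (M : SpaceFormModel V) (I : Set ℝ) (γ : ℝ → V) : Prop where
  smooth : ContDiffOn ℝ ∞ γ I
  mem : ∀ s ∈ I, γ s ∈ M.carrier
  unit_speed : ∀ s ∈ I, M.form (derivWithin γ I s) (derivWithin γ I s) = 1

/-- A smooth variation `Γ : (-ε, ε) × I → M` of `γ` which leaves `γ` unchanged outside the compact
interval `[a, b]` contained in the interior of `I`. -/
structure IsVariation (M : SpaceFormModel V) (I : Set ℝ) (γ : ℝ → V) (a b ε : ℝ)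
    (Γ : ℝ → ℝ → V) : Prop where
  eps_pos : 0 < ε
  lt : a < b
  subset : Set.Icc a b ⊆ interior I
  smooth : ContDiffOn ℝ ∞ (fun q : ℝ × ℝ => Γ q.1 q.2) (Set.Ioo (-ε) ε ×ˢ I)
  mem : ∀ t ∈ Set.Ioo (-ε) ε, ∀ s ∈ I, Γ t s ∈ M.carrier
  initial : ∀ s ∈ I, Γ 0 s = γ s
  fixed : ∀ t ∈ Set.Ioo (-ε) ε, ∀ s ∈ I \ Set.Icc a b, Γ t s = γ s

/-- `γ` is a critical point of the `p`-bienergy with respect to all smooth compactly supported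
variations. -/
def IsPBiharmonic (M : SpaceFormModel V) (p : ℝ) (I : Set ℝ) (γ : ℝ → V) : Prop :=
  ∀ (a b ε : ℝ) (Γ : ℝ → ℝ → V), M.IsVariation I γ a b ε Γ →
    HasDerivAt (fun t => M.pBienergy p I a b (Γ t)) 0 0

/-- A proper `1/2`-biharmonic curve (parametrized by arclength): a `1/2`-biharmonic curve whose
geodesic curvature `|∇_{γ'} γ'|` is not constant. The Euler-Lagrange operator contains the factor
`|∇_{γ'} γ'|^(-3/2)`, so the tension field is required to have no zeros. -/
structure IsProperHalfBiharmonic (M : SpaceFormModel V) (I : Set ℝ) (γ : ℝ → V) : Prop where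
  tension_ne_zero : ∀ s ∈ I, M.tension I γ s ≠ 0
  biharmonic : M.IsPBiharmonic (1 / 2) I γ
  nonconstant : ∃ s ∈ I, ∃ t ∈ I, M.len (M.tension I γ s) ≠ M.len (M.tension I γ t)

/-- `T = γ'`, `N`, `B` is a smooth Frenet frame along the unit speed curve `γ`, with geodesic
curvature `k > 0` and torsion `τ`. -/
structure IsFrenetFrame (M : SpaceFormModel V) (I : Set ℝ) (γ : ℝ → V) (k τ : ℝ → ℝ)
    (N B : ℝ → V) : Prop where
  smooth_N : ContDiffOn ℝ ∞ N I
  smooth_B : ContDiffOn ℝ ∞ B I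
  tangent_N : ∀ s ∈ I, M.tangentProj (γ s) (N s) = N s
  tangent_B : ∀ s ∈ I, M.tangentProj (γ s) (B s) = B s
  unit_N : ∀ s ∈ I, M.form (N s) (N s) = 1
  unit_B : ∀ s ∈ I, M.form (B s) (B s) = 1
  orth_TN : ∀ s ∈ I, M.form (derivWithin γ I s) (N s) = 0
  orth_TB : ∀ s ∈ I, M.form (derivWithin γ I s) (B s) = 0
  orth_NB : ∀ s ∈ I, M.form (N s) (B s) = 0
  k_pos : ∀ s ∈ I, 0 < k s
  cov_T : ∀ s ∈ I, M.covDeriv I γ (derivWithin γ I) s = k s • N s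
  cov_N : ∀ s ∈ I, M.covDeriv I γ N s = -(k s) • derivWithin γ I s + τ s • B s
  cov_B : ∀ s ∈ I, M.covDeriv I γ B s = -(τ s) • N s

end SpaceFormModel

end

/-!
Put `φ = k ^ (p - 1)`. The first variation of the `p`-bienergy at a Frenet curve pairs the
variation field with an operator whose component along `γ'` is `2 φ' k + φ k'`, up to a constant
factor. For `p = 1 / 2` this component vanishes identically, the binormal equation is
`(φ² τ)' = 0`, that is `τ = b k`, and the normal equation is then the Ermakov–Pinney equation
`φ'' + K φ = (1 + b²) / φ³`. Its first integral linearises it: the radius of curvature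
`u = φ² = 1 / k` satisfies `u'' + 4 K u = 2 C` and `u'² = 4 C u - 4 (1 + b²) - 4 K u²`, and it is
constant exactly when `C² = 4 K (1 + b²)`. These linear equations are solved explicitly for
`K = 1, 0, -1`.
-/

open Set Filter Topology MeasureTheory

section Calculus

variable {E F : Type*} [NormedAddCommGroup E] [NormedSpace ℝ E]
  [NormedAddCommGroup F] [NormedSpace ℝ F]

/-- The derivative of `f` in the constant direction `v`, as a function of the base point. -/
noncomputable def dirDeriv (v : E) (f : E → F) (x : E) : F := fderiv ℝ f x v

theorem contDiffOn_dirDeriv {f : E → F} {U : Set E} (hU : IsOpen U) (hf : ContDiffOn ℝ ∞ f U)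
    (v : E) : ContDiffOn ℝ ∞ (dirDeriv v f) U :=
  (hf.fderiv_of_isOpen hU (m := ∞) (by simp)).clm_apply contDiffOn_const

theorem dirDeriv_comm {f : E → F} {U : Set E} (hU : IsOpen U) (hf : ContDiffOn ℝ 2 f U) (v w : E)
    {x : E} (hx : x ∈ U) :
    dirDeriv v (dirDeriv w f) x = dirDeriv w (dirDeriv v f) x := by
  have hsymm : IsSymmSndFDerivAt ℝ f x :=
    (hf.contDiffAt (hU.mem_nhds hx)).isSymmSndFDerivAt (by simp)
  have hdiff : DifferentiableAt ℝ (fderiv ℝ f) x :=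
    ((hf.fderiv_of_isOpen hU (m := 1) (by norm_num)).contDiffAt (hU.mem_nhds hx)).differentiableAt
      one_ne_zero
  have hsnd : ∀ v w : E, dirDeriv v (dirDeriv w f) x = fderiv ℝ (fderiv ℝ f) x v w := by
    intro v w
    change fderiv ℝ (fun y => fderiv ℝ f y w) x v = _
    simp [(hdiff.hasFDerivAt.clm_apply (hasFDerivAt_const w x)).fderiv]
  rw [hsnd, hsnd, hsymm.eq]

theorem hasDerivAt_fst_slice {f : ℝ × ℝ → F} {t s : ℝ} (hf : DifferentiableAt ℝ f (t, s)) :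
    HasDerivAt (fun x => f (x, s)) (dirDeriv (1, 0) f (t, s)) t :=
  hf.hasFDerivAt.comp_hasDerivAt t ((hasDerivAt_id t).prodMk (hasDerivAt_const t s))

theorem hasDerivAt_snd_slice {f : ℝ × ℝ → F} {t s : ℝ} (hf : DifferentiableAt ℝ f (t, s)) :
    HasDerivAt (fun x => f (t, x)) (dirDeriv (0, 1) f (t, s)) s :=
  hf.hasFDerivAt.comp_hasDerivAt s ((hasDerivAt_const s t).prodMk (hasDerivAt_id s))

theorem hasDerivAt_intervalIntegral_of_contDiffOn {f : ℝ × ℝ → F} {U : Set (ℝ × ℝ)}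
    (hU : IsOpen U) (hf : ContDiffOn ℝ 1 f U) {a b t₀ : ℝ} (hsub : {t₀} ×ˢ uIcc a b ⊆ U) :
    HasDerivAt (fun t => ∫ s in a..b, f (t, s)) (∫ s in a..b, dirDeriv (1, 0) f (t₀, s)) t₀ := by
  obtain ⟨u, v, hu, -, ht₀u, hv, huv⟩ :=
    generalized_tube_lemma isCompact_singleton isCompact_uIcc hU hsub
  obtain ⟨δ, hδ, hball⟩ := Metric.nhds_basis_closedBall.mem_iff.1 (hu.mem_nhds (ht₀u rfl))
  have hK : Metric.closedBall t₀ δ ×ˢ uIcc a b ⊆ U := fun q hq => huv ⟨hball hq.1, hv hq.2⟩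
  have hfst : ContinuousOn (dirDeriv (1, 0) f) U :=
    (hf.continuousOn_fderiv_of_isOpen hU le_rfl).clm_apply continuousOn_const
  obtain ⟨C, hC⟩ := ((isCompact_closedBall t₀ δ).prod isCompact_uIcc).exists_bound_of_continuousOn
    (hfst.mono hK)
  have hslice : ∀ t ∈ Metric.closedBall t₀ δ, ∀ g : ℝ × ℝ → F, ContinuousOn g U →
      IntervalIntegrable (fun s => g (t, s)) volume a b := fun t ht g hg =>
    (hg.comp (by fun_prop) fun s hs => hK ⟨ht, hs⟩).intervalIntegrable
  have ht₀ : t₀ ∈ Metric.closedBall t₀ δ := Metric.mem_closedBall_self hδ.le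
  refine (intervalIntegral.hasDerivAt_integral_of_dominated_loc_of_deriv_le
    (F' := fun t s => dirDeriv (1, 0) f (t, s)) (bound := fun _ => C)
    (Metric.closedBall_mem_nhds t₀ hδ) ?_ (hslice t₀ ht₀ f hf.continuousOn)
    (hslice t₀ ht₀ _ hfst).def'.aestronglyMeasurable ?_ intervalIntegrable_const ?_).2
  · filter_upwards [Metric.closedBall_mem_nhds t₀ hδ] with t ht
    exact (hslice t ht f hf.continuousOn).def'.aestronglyMeasurable
  · exact Eventually.of_forall fun s hs t ht => hC (t, s) ⟨ht, uIoc_subset_uIcc hs⟩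
  · refine Eventually.of_forall fun s hs t ht => hasDerivAt_fst_slice ?_
    have hmem := hU.mem_nhds (hK (mk_mem_prod ht (uIoc_subset_uIcc hs)))
    exact (hf.contDiffAt hmem).differentiableAt one_ne_zero

theorem eqOn_zero_sdiff_Ioo_of_eqOn_zero_sdiff_Icc {Y : Type*} [TopologicalSpace Y] [T2Space Y]
    [Zero Y] {J : Set ℝ} (hJ : IsOpen J) {a b : ℝ} {f : ℝ → Y} (hf : ContinuousOn f J)
    (hzero : EqOn f 0 (J \ Icc a b)) : EqOn f 0 (J \ Ioo a b) := by
  refine hzero.of_subset_closure (hf.mono sdiff_subset) continuousOn_const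
    (sdiff_subset_sdiff_right Ioo_subset_Icc_self) ?_
  rw [sdiff_eq, sdiff_eq, ← interior_Icc, ← closure_compl]
  exact hJ.inter_closure

theorem exists_eq_const_of_hasDerivAt_zero {J : Set ℝ} (hJ : IsOpen J) (hJc : IsPreconnected J)
    {f : ℝ → F} (hf : ∀ s ∈ J, HasDerivAt f 0 s) : ∃ c, ∀ s ∈ J, f s = c :=
  hJ.exists_is_const_of_deriv_eq_zero hJc
    (fun s hs => (hf s hs).differentiableAt.differentiableWithinAt) fun s hs => (hf s hs).deriv

theorem subset_closure_interior_of_ordConnected {I : Set ℝ} (hI : I.OrdConnected)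
    (hI' : (interior I).Nonempty) : I ⊆ closure (interior I) := by
  rw [(hI.convex (𝕜 := ℝ)).closure_interior_eq_closure_of_nonempty_interior hI']
  exact subset_closure

theorem eq_zero_of_integral_mul_contDiffBump_eq_zero {J : Set ℝ} (hJ : IsOpen J) {f : ℝ → ℝ}
    (hf : ContinuousOn f J)
    (h : ∀ (c : ℝ) (φ : ContDiffBump c), Icc (c - φ.rOut) (c + φ.rOut) ⊆ J →
      ∫ s in (c - φ.rOut)..(c + φ.rOut), f s * φ s = 0) {c : ℝ} (hc : c ∈ J) : f c = 0 := by
  by_contra hne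
  have hsame_sign : ∀ᶠ x in 𝓝 c, x ∈ J ∧ 0 < f c * f x :=
    (hJ.eventually_mem hc).and <| ((hf.continuousAt (hJ.mem_nhds hc)).const_mul
      (f c)).eventually (lt_mem_nhds (mul_self_pos.2 hne))
  obtain ⟨r, hr, hball⟩ := Metric.nhds_basis_closedBall.mem_iff.1 hsame_sign
  rw [Real.closedBall_eq_Icc] at hball
  let φ : ContDiffBump c := ⟨r / 2, r, half_pos hr, half_lt_self hr⟩
  have hsub : Icc (c - φ.rOut) (c + φ.rOut) ⊆ J := fun x hx => (hball hx).1
  have hlt : c - φ.rOut < c + φ.rOut := by linarith [φ.rOut_pos]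
  have hint : IntervalIntegrable (fun s => f c * f s * φ s) volume (c - φ.rOut) (c + φ.rOut) := by
    refine ContinuousOn.intervalIntegrable ?_
    rw [uIcc_of_le hlt.le]
    exact (continuousOn_const.mul (hf.mono hsub)).mul φ.continuous.continuousOn
  have hpos := intervalIntegral.intervalIntegral_pos_of_pos_on hint (fun x hx =>
    mul_pos (hball (Ioo_subset_Icc_self hx)).2
      (φ.pos_of_mem_ball (by rwa [Real.ball_eq_Ioo]))) hlt
  simp only [mul_assoc, intervalIntegral.integral_const_mul, h c φ hsub, mul_zero] at hpos
  exact lt_irrefl _ hpos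

theorem hasDerivAt_derivWithin_of_mem_interior {f : ℝ → F} {I : Set ℝ}
    (hf : DifferentiableOn ℝ f I) {s : ℝ} (hs : s ∈ interior I) :
    HasDerivAt f (derivWithin f I s) s :=
  (hf s (interior_subset hs)).hasDerivWithinAt.hasDerivAt (mem_interior_iff_mem_nhds.1 hs)

theorem hasDerivAt_deriv_of_contDiffOn {f : ℝ → F} {J : Set ℝ} (hJ : IsOpen J)
    (hf : ContDiffOn ℝ ∞ f J) {s : ℝ} (hs : s ∈ J) : HasDerivAt f (deriv f s) s :=
  ((hf.differentiableOn (by simp)).differentiableAt (hJ.mem_nhds hs)).hasDerivAt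

theorem contDiffOn_deriv_of_isOpen {f : ℝ → F} {J : Set ℝ} (hJ : IsOpen J)
    (hf : ContDiffOn ℝ ∞ f J) : ContDiffOn ℝ ∞ (deriv f) J :=
  hf.deriv_of_isOpen hJ (by simp)

theorem hasDerivAt_dirDeriv_fst_snd_slice {f : ℝ × ℝ → F} {U : Set (ℝ × ℝ)} (hU : IsOpen U)
    (hf : ContDiffOn ℝ ∞ f U) {t s : ℝ} (h : (t, s) ∈ U) :
    HasDerivAt (fun x => dirDeriv (1, 0) f (t, x)) (dirDeriv (1, 0) (dirDeriv (0, 1) f) (t, s))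
      s := by
  rw [dirDeriv_comm hU (hf.of_le ENat.LEInfty.out) _ _ h]
  exact hasDerivAt_snd_slice
    (((contDiffOn_dirDeriv hU hf _).differentiableOn (by simp)).differentiableAt (hU.mem_nhds h))

theorem exists_sqrt_mul_sin_add_eq (p q : ℝ) :
    ∃ d, ∀ x, p * Real.cos x + q * Real.sin x = √(p ^ 2 + q ^ 2) * Real.sin (x + d) := by
  set z : ℂ := ⟨q, p⟩
  have hnorm : √(p ^ 2 + q ^ 2) = ‖z‖ := by
    rw [Complex.norm_def, Complex.normSq_apply, add_comm, sq, sq]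
  refine ⟨z.arg, fun x => ?_⟩
  have hcos : ‖z‖ * Real.cos z.arg = q := Complex.norm_mul_cos_arg z
  have hsin : ‖z‖ * Real.sin z.arg = p := Complex.norm_mul_sin_arg z
  rw [hnorm, Real.sin_add, ← hcos, ← hsin]
  ring

end Calculus

namespace SpaceFormModel

section Tangent

variable {V : Type*} [NormedAddCommGroup V] [NormedSpace ℝ V] {M : SpaceFormModel V} {x : V}

/-- The tangent space at a point `x` of the space form: the orthogonal complement of `x`, or all of
the ambient space in the flat case. -/
def tangentSpace (M : SpaceFormModel V) (x : V) : Submodule ℝ V := (M.curv • M.form x).ker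

theorem mem_tangentSpace {v : V} : v ∈ M.tangentSpace x ↔ M.curv * M.form x v = 0 := Iff.rfl

/-- `v` and `w` are orthonormal tangent vectors at the point `x` of the space form. -/
structure IsOrthonormalPair (M : SpaceFormModel V) (x v w : V) : Prop where
  mem_carrier : x ∈ M.carrier
  mem_left : v ∈ M.tangentSpace x
  mem_right : w ∈ M.tangentSpace x
  unit_left : M.form v v = 1
  unit_right : M.form w w = 1
  orth : M.form v w = 0

/-- A smooth vector product on the tangent spaces: `cr (x, v, w)` completes an orthonormal pair
`v, w` of tangent vectors at `x` to an orthonormal basis. -/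
structure IsCrossProduct (M : SpaceFormModel V) (cr : V × V × V → V) : Prop where
  contDiff : ContDiff ℝ ∞ cr
  mem_tangentSpace : ∀ {x v w}, M.IsOrthonormalPair x v w → cr (x, v, w) ∈ M.tangentSpace x
  unit : ∀ {x v w}, M.IsOrthonormalPair x v w → M.form (cr (x, v, w)) (cr (x, v, w)) = 1
  orth_left : ∀ {x v w}, M.IsOrthonormalPair x v w → M.form v (cr (x, v, w)) = 0
  orth_right : ∀ {x v w}, M.IsOrthonormalPair x v w → M.form w (cr (x, v, w)) = 0
  eq_zero : ∀ {x v w}, M.IsOrthonormalPair x v w → ∀ d ∈ M.tangentSpace x, M.form v d = 0 →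
    M.form w d = 0 → M.form (cr (x, v, w)) d = 0 → d = 0

/-- The properties of the three models on which the theory of curves depends. -/
structure IsSpaceForm (M : SpaceFormModel V) : Prop where
  symm : ∀ x y, M.form x y = M.form y x
  curv_cases : M.curv = 0 ∨ M.curv = 1 ∨ M.curv = -1
  curv_mul_form_self : ∀ x ∈ M.carrier, M.curv * M.form x x = M.curv ^ 2
  normalize_mem : ∀ x ∈ M.carrier, ∀ v ∈ M.tangentSpace x, 0 < 1 + M.curv * M.form v v →
    (√(1 + M.curv * M.form v v))⁻¹ • (x + v) ∈ M.carrier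
  pos : ∀ x ∈ M.carrier, ∀ v ∈ M.tangentSpace x, v ≠ 0 → 0 < M.form v v
  exists_isCrossProduct : ∃ cr, M.IsCrossProduct cr

theorem IsSpaceForm.curv_pow_three (hM : M.IsSpaceForm) : M.curv ^ 3 = M.curv := by
  rcases hM.curv_cases with h | h | h <;> rw [h] <;> norm_num

theorem IsSpaceForm.tangentProj_mem (hM : M.IsSpaceForm) (hx : x ∈ M.carrier) (v : V) :
    M.tangentProj x v ∈ M.tangentSpace x := by
  simp only [mem_tangentSpace, tangentProj, map_sub, map_smul, smul_eq_mul, hM.symm v x]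
  linear_combination (-M.curv * M.form x v) * hM.curv_mul_form_self x hx -
    M.form x v * hM.curv_pow_three

theorem IsSpaceForm.tangentProj_eq_self (hM : M.IsSpaceForm) {v : V} (hv : v ∈ M.tangentSpace x) :
    M.tangentProj x v = v := by
  rw [tangentProj, hM.symm, mem_tangentSpace.1 hv, zero_smul, sub_zero]

theorem form_tangentProj {v : V} (hv : v ∈ M.tangentSpace x) (hM : M.IsSpaceForm) (w : V) :
    M.form v (M.tangentProj x w) = M.form v w := by
  simp only [tangentProj, map_sub, map_smul, smul_eq_mul, hM.symm v x]
  linear_combination (-M.form w x) * mem_tangentSpace.1 hv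

theorem IsCrossProduct.eq_sum_form {cr : V × V × V → V} (hcr : M.IsCrossProduct cr)
    (hM : M.IsSpaceForm) {v w d : V} (h : M.IsOrthonormalPair x v w) (hd : d ∈ M.tangentSpace x) :
    d = M.form v d • v + M.form w d • w + M.form (cr (x, v, w)) d • cr (x, v, w) := by
  have hsum_mem := add_mem (add_mem (Submodule.smul_mem _ (M.form v d) h.mem_left)
    (Submodule.smul_mem _ (M.form w d) h.mem_right))
    (Submodule.smul_mem _ (M.form (cr (x, v, w)) d) (hcr.mem_tangentSpace h))
  refine sub_eq_zero.1 (hcr.eq_zero h _ (sub_mem hd hsum_mem) ?_ ?_ ?_)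
  · simp [h.unit_left, h.orth, hcr.orth_left h]
  · simp [h.unit_right, hM.symm w v, h.orth, hcr.orth_right h]
  · simp [hcr.unit h, hM.symm _ v, hcr.orth_left h, hM.symm _ w, hcr.orth_right h]

end Tangent

section FormCalculus

variable {V : Type*} [NormedAddCommGroup V] [NormedSpace ℝ V] [FiniteDimensional ℝ V]
  (M : SpaceFormModel V)

theorem contDiffOn_form {E : Type*} [NormedAddCommGroup E] [NormedSpace ℝ E] {n : WithTop ℕ∞}
    {f g : E → V} {S : Set E} (hf : ContDiffOn ℝ n f S) (hg : ContDiffOn ℝ n g S) :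
    ContDiffOn ℝ n (fun x => M.form (f x) (g x)) S :=
  (M.form.toContinuousBilinearMap.contDiff.comp_contDiffOn hf).clm_apply hg

theorem continuousOn_form {E : Type*} [TopologicalSpace E] {f g : E → V} {S : Set E}
    (hf : ContinuousOn f S) (hg : ContinuousOn g S) :
    ContinuousOn (fun x => M.form (f x) (g x)) S :=
  (M.form.toContinuousBilinearMap.continuous.comp_continuousOn hf).clm_apply hg

theorem hasDerivWithinAt_form {f g : ℝ → V} {f' g' : V} {S : Set ℝ} {s : ℝ}
    (hf : HasDerivWithinAt f f' S s) (hg : HasDerivWithinAt g g' S s) :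
    HasDerivWithinAt (fun x => M.form (f x) (g x)) (M.form (f s) g' + M.form f' (g s)) S s :=
  M.form.toContinuousBilinearMap.hasDerivWithinAt_of_bilinear hf hg

theorem hasDerivAt_form {f g : ℝ → V} {f' g' : V} {s : ℝ} (hf : HasDerivAt f f' s)
    (hg : HasDerivAt g g' s) :
    HasDerivAt (fun x => M.form (f x) (g x)) (M.form (f s) g' + M.form f' (g s)) s :=
  M.form.toContinuousBilinearMap.hasDerivAt_of_bilinear (fun _ => hf) (fun _ => hg)

theorem integral_form_sub_form_deriv_eq {G P H E X X' X'' : ℝ → V} {a b : ℝ}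
    (hG : ∀ s ∈ uIcc a b, HasDerivAt G (-P s - H s) s)
    (hP : ∀ s ∈ uIcc a b, HasDerivAt P (-E s) s) (hX : ∀ s ∈ uIcc a b, HasDerivAt X (X' s) s)
    (hX' : ∀ s ∈ uIcc a b, HasDerivAt X' (X'' s) s) (hcX'' : ContinuousOn X'' (uIcc a b))
    (hcH : ContinuousOn H (uIcc a b)) (hcE : ContinuousOn E (uIcc a b))
    (ha : X a = 0) (ha' : X' a = 0) (hb : X b = 0) (hb' : X' b = 0) :
    ∫ s in a..b, (M.form (G s) (X'' s) - M.form (H s) (X' s)) =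
      ∫ s in a..b, M.form (E s) (X s) := by
  have hcont : ∀ {f f' : ℝ → V}, (∀ s ∈ uIcc a b, HasDerivAt f (f' s) s) →
      ContinuousOn f (uIcc a b) := fun hf s hs => (hf s hs).continuousAt.continuousWithinAt
  have hint : IntervalIntegrable (fun s => M.form (G s) (X'' s) - M.form (H s) (X' s)) volume a b :=
    ((continuousOn_form M (hcont hG) hcX'').sub
      (continuousOn_form M hcH (hcont hX'))).intervalIntegrable
  have hint' : IntervalIntegrable (fun s => M.form (E s) (X s)) volume a b :=
    (continuousOn_form M hcE (hcont hX)).intervalIntegrable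
  have hboundary : ∀ s ∈ uIcc a b, HasDerivAt (fun s => M.form (G s) (X' s) + M.form (P s) (X s))
      (M.form (G s) (X'' s) - M.form (H s) (X' s) - M.form (E s) (X s)) s := by
    intro s hs
    refine ((hasDerivAt_form M (hG s hs) (hX' s hs)).add
      (hasDerivAt_form M (hP s hs) (hX s hs))).congr_deriv ?_
    simp only [map_sub, map_neg, LinearMap.sub_apply, LinearMap.neg_apply]
    ring
  have hftc := intervalIntegral.integral_eq_sub_of_hasDerivAt hboundary (hint.sub hint')
  rw [intervalIntegral.integral_sub hint hint', ha, ha', hb, hb'] at hftc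
  simpa [sub_eq_zero] using hftc

variable {M} {I : Set ℝ}

theorem form_derivWithin_add_eq_zero {f g : ℝ → V} (hU : UniqueDiffOn ℝ I)
    (hf : DifferentiableOn ℝ f I) (hg : DifferentiableOn ℝ g I) {c C : ℝ}
    (hC : ∀ s ∈ I, c * M.form (f s) (g s) = C) {s : ℝ} (hs : s ∈ I) :
    c * (M.form (f s) (derivWithin g I s) + M.form (derivWithin f I s) (g s)) = 0 := by
  have hform := (hasDerivWithinAt_form M (hf s hs).hasDerivWithinAt
    (hg s hs).hasDerivWithinAt).const_mul c
  have hconst : HasDerivWithinAt (fun x => c * M.form (f x) (g x)) 0 I s :=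
    (hasDerivWithinAt_const s I C).congr hC (hC s hs)
  exact (hU s hs).eq_deriv _ hform hconst

theorem form_covDeriv_add_eq_zero (hM : M.IsSpaceForm) (hU : UniqueDiffOn ℝ I) {γ X Y : ℝ → V}
    (hX : DifferentiableOn ℝ X I) (hY : DifferentiableOn ℝ Y I)
    (hXγ : ∀ s ∈ I, X s ∈ M.tangentSpace (γ s)) (hYγ : ∀ s ∈ I, Y s ∈ M.tangentSpace (γ s))
    {C : ℝ} (hC : ∀ s ∈ I, M.form (X s) (Y s) = C) {s : ℝ} (hs : s ∈ I) :
    M.form (X s) (M.covDeriv I γ Y s) + M.form (Y s) (M.covDeriv I γ X s) = 0 := by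
  have h := form_derivWithin_add_eq_zero (c := 1) hU hX hY (fun s hs => by rw [one_mul, hC s hs]) hs
  rw [covDeriv, covDeriv, form_tangentProj (hXγ s hs) hM, form_tangentProj (hYγ s hs) hM,
    hM.symm (Y s), ← h, one_mul]

end FormCalculus

section Curves

variable {V : Type*} [NormedAddCommGroup V] [NormedSpace ℝ V] {M : SpaceFormModel V}
  {I : Set ℝ} {γ N B : ℝ → V} {k τ : ℝ → ℝ} {s : ℝ}

theorem IsUnitSpeedCurve.smooth_velocity (hγ : M.IsUnitSpeedCurve I γ) (hU : UniqueDiffOn ℝ I) :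
    ContDiffOn ℝ ∞ (derivWithin γ I) I := hγ.smooth.derivWithin hU (by simp)

theorem covDeriv_mem_tangentSpace (hM : M.IsSpaceForm) (hγ : M.IsUnitSpeedCurve I γ)
    (X : ℝ → V) (hs : s ∈ I) : M.covDeriv I γ X s ∈ M.tangentSpace (γ s) :=
  hM.tangentProj_mem (hγ.mem s hs) _

theorem IsFrenetFrame.len_tension (hF : M.IsFrenetFrame I γ k τ N B) (hs : s ∈ I) :
    M.len (M.tension I γ s) = k s := by
  rw [tension, hF.cov_T s hs, len]
  simp only [map_smul, LinearMap.smul_apply, hF.unit_N s hs, smul_eq_mul, mul_one]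
  exact Real.sqrt_mul_self (hF.k_pos s hs).le

theorem IsFrenetFrame.normal_mem (hM : M.IsSpaceForm) (hγ : M.IsUnitSpeedCurve I γ)
    (hF : M.IsFrenetFrame I γ k τ N B) (hs : s ∈ I) : N s ∈ M.tangentSpace (γ s) := by
  rw [← hF.tangent_N s hs]
  exact hM.tangentProj_mem (hγ.mem s hs) _

theorem IsFrenetFrame.binormal_mem (hM : M.IsSpaceForm) (hγ : M.IsUnitSpeedCurve I γ)
    (hF : M.IsFrenetFrame I γ k τ N B) (hs : s ∈ I) : B s ∈ M.tangentSpace (γ s) := by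
  rw [← hF.tangent_B s hs]
  exact hM.tangentProj_mem (hγ.mem s hs) _

variable [FiniteDimensional ℝ V]

namespace IsUnitSpeedCurve

variable (hM : M.IsSpaceForm) (hU : UniqueDiffOn ℝ I) (hγ : M.IsUnitSpeedCurve I γ)

include hM hU hγ

theorem velocity_mem (hs : s ∈ I) : derivWithin γ I s ∈ M.tangentSpace (γ s) := by
  have hdiff := hγ.smooth.differentiableOn (by simp)
  have h := form_derivWithin_add_eq_zero hU hdiff hdiff
    (fun s hs => hM.curv_mul_form_self _ (hγ.mem s hs)) hs
  rw [hM.symm (derivWithin γ I s)] at h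
  rw [mem_tangentSpace]
  linarith

theorem covDeriv_eq {X : ℝ → V} (hX : DifferentiableOn ℝ X I)
    (hXγ : ∀ s ∈ I, X s ∈ M.tangentSpace (γ s)) (hs : s ∈ I) :
    M.covDeriv I γ X s =
      derivWithin X I s + (M.curv * M.form (derivWithin γ I s) (X s)) • γ s := by
  have h := form_derivWithin_add_eq_zero hU (hγ.smooth.differentiableOn (by simp)) hX hXγ hs
  rw [hM.symm (γ s), mul_add] at h
  rw [covDeriv, tangentProj, eq_neg_of_add_eq_zero_left h, neg_smul, sub_neg_eq_add]

theorem derivWithin_velocity (hs : s ∈ I) :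
    derivWithin (derivWithin γ I) I s = M.tension I γ s - M.curv • γ s := by
  rw [tension, hγ.covDeriv_eq hM hU ((hγ.smooth_velocity hU).differentiableOn (by simp))
    (fun s hs => hγ.velocity_mem hM hU hs) hs, hγ.unit_speed s hs, mul_one, add_sub_cancel_right]

theorem form_velocity_tension (hs : s ∈ I) :
    M.form (derivWithin γ I s) (M.tension I γ s) = 0 := by
  have hdiff := (hγ.smooth_velocity hU).differentiableOn (by simp)
  have hmem := fun s hs => hγ.velocity_mem hM hU (s := s) hs
  have h := form_covDeriv_add_eq_zero hM hU hdiff hdiff hmem hmem hγ.unit_speed hs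
  change M.form _ (M.tension I γ s) + M.form _ (M.tension I γ s) = 0 at h
  linarith

theorem smooth_tension : ContDiffOn ℝ ∞ (M.tension I γ) I := by
  refine (((hγ.smooth_velocity hU).derivWithin hU (m := ∞) (by simp)).add
    (hγ.smooth.const_smul M.curv)).congr fun s hs => ?_
  simp [hγ.derivWithin_velocity hM hU hs]

end IsUnitSpeedCurve

namespace IsFrenetFrame

variable (hM : M.IsSpaceForm) (hU : UniqueDiffOn ℝ I) (hγ : M.IsUnitSpeedCurve I γ)
  (hF : M.IsFrenetFrame I γ k τ N B)

include hM hU hγ hF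

theorem derivWithin_velocity (hs : s ∈ I) :
    derivWithin (derivWithin γ I) I s = k s • N s - M.curv • γ s := by
  rw [hγ.derivWithin_velocity hM hU hs, tension, hF.cov_T s hs]

theorem derivWithin_normal (hs : s ∈ I) :
    derivWithin N I s = -(k s) • derivWithin γ I s + τ s • B s := by
  rw [← hF.cov_N s hs, hγ.covDeriv_eq hM hU (hF.smooth_N.differentiableOn (by simp))
    (fun s hs => hF.normal_mem hM hγ hs) hs, hF.orth_TN s hs, mul_zero, zero_smul, add_zero]

theorem derivWithin_binormal (hs : s ∈ I) : derivWithin B I s = -(τ s) • N s := by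
  rw [← hF.cov_B s hs, hγ.covDeriv_eq hM hU (hF.smooth_B.differentiableOn (by simp))
    (fun s hs => hF.binormal_mem hM hγ hs) hs, hF.orth_TB s hs, mul_zero, zero_smul, add_zero]

theorem smooth_curvature : ContDiffOn ℝ ∞ k I := by
  refine (contDiffOn_form M (hγ.smooth_tension hM hU) hF.smooth_N).congr fun s hs => ?_
  simp [tension, hF.cov_T s hs, hF.unit_N s hs]

theorem smooth_torsion : ContDiffOn ℝ ∞ τ I := by
  refine (contDiffOn_form M (hF.smooth_N.derivWithin hU (m := ∞) (by simp)) hF.smooth_B).congr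
    fun s hs => ?_
  simp [hF.derivWithin_normal hM hU hγ hs, hF.unit_B s hs, hF.orth_TB s hs]

end IsFrenetFrame

end Curves

section FrenetFrame

variable {V : Type*} [NormedAddCommGroup V] [NormedSpace ℝ V] {M : SpaceFormModel V}
  {I : Set ℝ} {γ : ℝ → V} {s : ℝ}

/-- The principal normal of a curve: its tension field, normalized. It takes the value `0` where
the tension field vanishes. -/
noncomputable def principalNormal (M : SpaceFormModel V) (I : Set ℝ) (γ : ℝ → V) (s : ℝ) : V :=
  (M.len (M.tension I γ s))⁻¹ • M.tension I γ s

/-- The binormal of a curve with respect to the vector product `cr`. -/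
noncomputable def binormal (M : SpaceFormModel V) (cr : V × V × V → V) (I : Set ℝ) (γ : ℝ → V)
    (s : ℝ) : V :=
  cr (γ s, derivWithin γ I s, M.principalNormal I γ s)

theorem form_tension_self_pos (hM : M.IsSpaceForm) (hγ : M.IsUnitSpeedCurve I γ)
    (hs : s ∈ I) (h0 : M.tension I γ s ≠ 0) :
    0 < M.form (M.tension I γ s) (M.tension I γ s) :=
  hM.pos _ (hγ.mem s hs) _ (covDeriv_mem_tangentSpace hM hγ _ hs) h0

theorem len_tension_smul_principalNormal (hM : M.IsSpaceForm) (hγ : M.IsUnitSpeedCurve I γ)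
    (hs : s ∈ I) (h0 : M.tension I γ s ≠ 0) :
    M.len (M.tension I γ s) • M.principalNormal I γ s = M.tension I γ s :=
  smul_inv_smul₀ (Real.sqrt_pos.2 (form_tension_self_pos hM hγ hs h0)).ne' _

variable [FiniteDimensional ℝ V]

theorem isOrthonormalPair_velocity_principalNormal (hM : M.IsSpaceForm) (hU : UniqueDiffOn ℝ I)
    (hγ : M.IsUnitSpeedCurve I γ) (hs : s ∈ I) (h0 : M.tension I γ s ≠ 0) :
    M.IsOrthonormalPair (γ s) (derivWithin γ I s) (M.principalNormal I γ s) where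
  mem_carrier := hγ.mem s hs
  mem_left := hγ.velocity_mem hM hU hs
  mem_right := Submodule.smul_mem _ _ (covDeriv_mem_tangentSpace hM hγ _ hs)
  unit_left := hγ.unit_speed s hs
  unit_right := by
    have hpos := form_tension_self_pos hM hγ hs h0
    simp only [principalNormal, len, map_smul, LinearMap.smul_apply, smul_eq_mul]
    rw [← mul_assoc, ← mul_inv, Real.mul_self_sqrt hpos.le, inv_mul_cancel₀ hpos.ne']
  orth := by
    rw [principalNormal, map_smul, hγ.form_velocity_tension hM hU hs, smul_zero]

theorem smooth_principalNormal (hM : M.IsSpaceForm) (hU : UniqueDiffOn ℝ I)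
    (hγ : M.IsUnitSpeedCurve I γ) (h0 : ∀ s ∈ I, M.tension I γ s ≠ 0) :
    ContDiffOn ℝ ∞ (M.principalNormal I γ) I := by
  have hsmooth := hγ.smooth_tension hM hU
  have hpos := fun s hs => form_tension_self_pos hM hγ hs (h0 s hs)
  have hlen : ContDiffOn ℝ ∞ (fun s => M.len (M.tension I γ s)) I :=
    (contDiffOn_form M hsmooth hsmooth).sqrt fun s hs => (hpos s hs).ne'
  exact (hlen.inv fun s hs => (Real.sqrt_pos.2 (hpos s hs)).ne').smul hsmooth

theorem covDeriv_principalNormal (hM : M.IsSpaceForm) (hU : UniqueDiffOn ℝ I)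
    (hγ : M.IsUnitSpeedCurve I γ) (h0 : ∀ s ∈ I, M.tension I γ s ≠ 0) {cr : V × V × V → V}
    (hcr : M.IsCrossProduct cr) (hs : s ∈ I) :
    M.covDeriv I γ (M.principalNormal I γ) s = -(M.len (M.tension I γ s)) • derivWithin γ I s +
      M.form (M.binormal cr I γ s) (M.covDeriv I γ (M.principalNormal I γ) s) •
        M.binormal cr I γ s := by
  have hpair := fun s hs =>
    isOrthonormalPair_velocity_principalNormal hM hU hγ (s := s) hs (h0 s hs)
  have hT := (hγ.smooth_velocity hU).differentiableOn (by simp)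
  have hN := (smooth_principalNormal hM hU hγ h0).differentiableOn (by simp)
  have hTN := form_covDeriv_add_eq_zero hM hU hT hN (fun s hs => (hpair s hs).mem_left)
    (fun s hs => (hpair s hs).mem_right) (fun s hs => (hpair s hs).orth) hs
  have hNN := form_covDeriv_add_eq_zero hM hU hN hN (fun s hs => (hpair s hs).mem_right)
    (fun s hs => (hpair s hs).mem_right) (fun s hs => (hpair s hs).unit_right) hs
  change _ + M.form _ (M.tension I γ s) = 0 at hTN
  rw [← len_tension_smul_principalNormal hM hγ hs (h0 s hs), map_smul, smul_eq_mul,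
    (hpair s hs).unit_right, mul_one] at hTN
  have hexpand := hcr.eq_sum_form hM (hpair s hs)
    (covDeriv_mem_tangentSpace hM hγ (M.principalNormal I γ) hs)
  rw [eq_neg_of_add_eq_zero_left hTN, add_self_eq_zero.1 hNN, zero_smul, add_zero] at hexpand
  exact hexpand

theorem smooth_binormal (hM : M.IsSpaceForm) (hU : UniqueDiffOn ℝ I)
    (hγ : M.IsUnitSpeedCurve I γ) (h0 : ∀ s ∈ I, M.tension I γ s ≠ 0) {cr : V × V × V → V}
    (hcr : M.IsCrossProduct cr) : ContDiffOn ℝ ∞ (M.binormal cr I γ) I :=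
  hcr.contDiff.comp_contDiffOn (hγ.smooth.prodMk ((hγ.smooth_velocity hU).prodMk
    (smooth_principalNormal hM hU hγ h0)))

theorem covDeriv_binormal (hM : M.IsSpaceForm) (hU : UniqueDiffOn ℝ I)
    (hγ : M.IsUnitSpeedCurve I γ) (h0 : ∀ s ∈ I, M.tension I γ s ≠ 0) {cr : V × V × V → V}
    (hcr : M.IsCrossProduct cr) (hs : s ∈ I) :
    M.covDeriv I γ (M.binormal cr I γ) s =
      -M.form (M.binormal cr I γ s) (M.covDeriv I γ (M.principalNormal I γ) s) •
        M.principalNormal I γ s := by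
  have hpair := fun s hs =>
    isOrthonormalPair_velocity_principalNormal hM hU hγ (s := s) hs (h0 s hs)
  have hBmem : ∀ s ∈ I, M.binormal cr I γ s ∈ M.tangentSpace (γ s) :=
    fun s hs => hcr.mem_tangentSpace (hpair s hs)
  have hT := (hγ.smooth_velocity hU).differentiableOn (by simp)
  have hN := (smooth_principalNormal hM hU hγ h0).differentiableOn (by simp)
  have hB := (smooth_binormal hM hU hγ h0 hcr).differentiableOn (by simp)
  have hTB := form_covDeriv_add_eq_zero hM hU hT hB (fun s hs => (hpair s hs).mem_left) hBmem
    (fun s hs => hcr.orth_left (hpair s hs)) hs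
  have hNB := form_covDeriv_add_eq_zero hM hU hN hB (fun s hs => (hpair s hs).mem_right) hBmem
    (fun s hs => hcr.orth_right (hpair s hs)) hs
  have hBB := form_covDeriv_add_eq_zero hM hU hB hB hBmem hBmem
    (fun s hs => hcr.unit (hpair s hs)) hs
  change _ + M.form _ (M.tension I γ s) = 0 at hTB
  rw [← len_tension_smul_principalNormal hM hγ hs (h0 s hs), map_smul, hM.symm (M.binormal _ _ _ _),
    binormal, hcr.orth_right (hpair s hs), smul_zero, add_zero] at hTB
  have hexpand := hcr.eq_sum_form hM (hpair s hs)
    (covDeriv_mem_tangentSpace hM hγ (M.binormal cr I γ) hs)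
  change _ = _ + _ + M.form (M.binormal cr I γ s) _ • _ at hexpand
  rw [hTB, eq_neg_of_add_eq_zero_left hNB, add_self_eq_zero.1 hBB, zero_smul, zero_smul, zero_add,
    add_zero] at hexpand
  exact hexpand

theorem isFrenetFrame_principalNormal_binormal (hM : M.IsSpaceForm) (hU : UniqueDiffOn ℝ I)
    (hγ : M.IsUnitSpeedCurve I γ) (h0 : ∀ s ∈ I, M.tension I γ s ≠ 0) {cr : V × V × V → V}
    (hcr : M.IsCrossProduct cr) :
    M.IsFrenetFrame I γ (fun s => M.len (M.tension I γ s))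
      (fun s => M.form (M.binormal cr I γ s) (M.covDeriv I γ (M.principalNormal I γ) s))
      (M.principalNormal I γ) (M.binormal cr I γ) :=
  have hpair := fun s hs =>
    isOrthonormalPair_velocity_principalNormal hM hU hγ (s := s) hs (h0 s hs)
  { smooth_N := smooth_principalNormal hM hU hγ h0
    smooth_B := smooth_binormal hM hU hγ h0 hcr
    tangent_N := fun s hs => hM.tangentProj_eq_self (hpair s hs).mem_right
    tangent_B := fun s hs => hM.tangentProj_eq_self (hcr.mem_tangentSpace (hpair s hs))
    unit_N := fun s hs => (hpair s hs).unit_right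
    unit_B := fun s hs => hcr.unit (hpair s hs)
    orth_TN := fun s hs => (hpair s hs).orth
    orth_TB := fun s hs => hcr.orth_left (hpair s hs)
    orth_NB := fun s hs => hcr.orth_right (hpair s hs)
    k_pos := fun s hs => Real.sqrt_pos.2 (form_tension_self_pos hM hγ hs (h0 s hs))
    cov_T := fun s hs => (len_tension_smul_principalNormal hM hγ hs (h0 s hs)).symm
    cov_N := fun _ hs => covDeriv_principalNormal hM hU hγ h0 hcr hs
    cov_B := fun _ hs => covDeriv_binormal hM hU hγ h0 hcr hs }

theorem IsUnitSpeedCurve.exists_isFrenetFrame (hM : M.IsSpaceForm) (hU : UniqueDiffOn ℝ I)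
    (hγ : M.IsUnitSpeedCurve I γ) (h0 : ∀ s ∈ I, M.tension I γ s ≠ 0) :
    ∃ (k τ : ℝ → ℝ) (N B : ℝ → V), M.IsFrenetFrame I γ k τ N B := by
  obtain ⟨cr, hcr⟩ := hM.exists_isCrossProduct
  exact ⟨_, _, _, _, isFrenetFrame_principalNormal_binormal hM hU hγ h0 hcr⟩

end FrenetFrame

section FirstVariation

variable {V : Type*} [NormedAddCommGroup V] [NormedSpace ℝ V] {M : SpaceFormModel V}
  {I : Set ℝ} {γ N B : ℝ → V} {k τ : ℝ → ℝ} {a b ε t s : ℝ} {Γ : ℝ → ℝ → V}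

/-- The variation field `∂Γ/∂t` at `t = 0` of a family of curves `Γ t`. -/
noncomputable def variationField (Γ : ℝ → ℝ → V) (s : ℝ) : V :=
  dirDeriv (1, 0) (Function.uncurry Γ) (0, s)

/-- The squared length of the tension field of the curve `Γ t` at `s`, in terms of the ambient
velocity and acceleration and as a function of the pair `(t, s)`. -/
noncomputable def tensionSq (M : SpaceFormModel V) (Γ : ℝ → ℝ → V) (q : ℝ × ℝ) : ℝ :=
  M.form (dirDeriv (0, 1) (dirDeriv (0, 1) (Function.uncurry Γ)) q)
      (dirDeriv (0, 1) (dirDeriv (0, 1) (Function.uncurry Γ)) q) -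
    M.curv * M.form (dirDeriv (0, 1) (Function.uncurry Γ) q)
      (dirDeriv (0, 1) (Function.uncurry Γ) q) ^ 2

theorem IsSpaceForm.form_tangentProj_self (hM : M.IsSpaceForm) {x v w : V} (hx : x ∈ M.carrier)
    (h : M.curv * (M.form x w + M.form v v) = 0) :
    M.form (M.tangentProj x w) (M.tangentProj x w) = M.form w w - M.curv * M.form v v ^ 2 := by
  simp only [tangentProj, map_sub, map_smul, smul_eq_mul, LinearMap.sub_apply,
    LinearMap.smul_apply, hM.symm w x]
  linear_combination (M.curv * M.form x w ^ 2) * hM.curv_mul_form_self x hx +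
    M.form x w ^ 2 * hM.curv_pow_three - (M.form x w - M.form v v) * h

namespace IsVariation

theorem zero_mem (hΓ : M.IsVariation I γ a b ε Γ) : (0 : ℝ) ∈ Ioo (-ε) ε :=
  ⟨neg_lt_zero.2 hΓ.eps_pos, hΓ.eps_pos⟩

theorem isOpen_domain : IsOpen (Ioo (-ε) ε ×ˢ interior I) := isOpen_Ioo.prod isOpen_interior

theorem smooth_uncurry (hΓ : M.IsVariation I γ a b ε Γ) :
    ContDiffOn ℝ ∞ (Function.uncurry Γ) (Ioo (-ε) ε ×ˢ interior I) :=
  hΓ.smooth.mono (prod_mono_right interior_subset)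

theorem smooth_velocity (hΓ : M.IsVariation I γ a b ε Γ) :
    ContDiffOn ℝ ∞ (dirDeriv (0, 1) (Function.uncurry Γ)) (Ioo (-ε) ε ×ˢ interior I) :=
  contDiffOn_dirDeriv isOpen_domain hΓ.smooth_uncurry _

theorem smooth_acceleration (hΓ : M.IsVariation I γ a b ε Γ) :
    ContDiffOn ℝ ∞ (dirDeriv (0, 1) (dirDeriv (0, 1) (Function.uncurry Γ)))
      (Ioo (-ε) ε ×ˢ interior I) :=
  contDiffOn_dirDeriv isOpen_domain hΓ.smooth_velocity _

theorem differentiableAt_of_contDiffOn {F : Type*} [NormedAddCommGroup F] [NormedSpace ℝ F]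
    {f : ℝ × ℝ → F} (hf : ContDiffOn ℝ ∞ f (Ioo (-ε) ε ×ˢ interior I)) (ht : t ∈ Ioo (-ε) ε)
    (hs : s ∈ interior I) : DifferentiableAt ℝ f (t, s) :=
  (hf.differentiableOn (by simp)).differentiableAt (isOpen_domain.mem_nhds ⟨ht, hs⟩)

theorem derivWithin_eq (hΓ : M.IsVariation I γ a b ε Γ) (hU : UniqueDiffOn ℝ I)
    (ht : t ∈ Ioo (-ε) ε) (hs : s ∈ interior I) :
    derivWithin (Γ t) I s = dirDeriv (0, 1) (Function.uncurry Γ) (t, s) :=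
  (hasDerivAt_snd_slice (differentiableAt_of_contDiffOn hΓ.smooth_uncurry ht
    hs)).hasDerivWithinAt.derivWithin (hU s (interior_subset hs))

theorem derivWithin_derivWithin_eq (hΓ : M.IsVariation I γ a b ε Γ) (hU : UniqueDiffOn ℝ I)
    (ht : t ∈ Ioo (-ε) ε) (hs : s ∈ interior I) :
    derivWithin (derivWithin (Γ t) I) I s =
      dirDeriv (0, 1) (dirDeriv (0, 1) (Function.uncurry Γ)) (t, s) := by
  have hslice := hasDerivAt_snd_slice (differentiableAt_of_contDiffOn hΓ.smooth_velocity ht hs)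
  have heq : derivWithin (Γ t) I =ᶠ[𝓝 s] fun x => dirDeriv (0, 1) (Function.uncurry Γ) (t, x) := by
    filter_upwards [isOpen_interior.mem_nhds hs] with x hx using hΓ.derivWithin_eq hU ht hx
  exact (hslice.congr_of_eventuallyEq heq).hasDerivWithinAt.derivWithin
    (hU s (interior_subset hs))

theorem velocity_zero (hΓ : M.IsVariation I γ a b ε Γ) (hU : UniqueDiffOn ℝ I)
    (hs : s ∈ interior I) :
    dirDeriv (0, 1) (Function.uncurry Γ) (0, s) = derivWithin γ I s := by
  rw [← hΓ.derivWithin_eq hU hΓ.zero_mem hs]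
  exact derivWithin_congr hΓ.initial (hΓ.initial s (interior_subset hs))

theorem acceleration_zero (hΓ : M.IsVariation I γ a b ε Γ) (hU : UniqueDiffOn ℝ I)
    (hs : s ∈ interior I) :
    dirDeriv (0, 1) (dirDeriv (0, 1) (Function.uncurry Γ)) (0, s) =
      derivWithin (derivWithin γ I) I s := by
  have heq : EqOn (derivWithin (Γ 0) I) (derivWithin γ I) I := fun x hx =>
    derivWithin_congr hΓ.initial (hΓ.initial x hx)
  rw [← hΓ.derivWithin_derivWithin_eq hU hΓ.zero_mem hs]
  exact derivWithin_congr heq (heq (interior_subset hs))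

theorem hasDerivAt_variationField (hΓ : M.IsVariation I γ a b ε Γ) (hs : s ∈ interior I) :
    HasDerivAt (fun t => Γ t s) (variationField Γ s) 0 :=
  hasDerivAt_fst_slice (differentiableAt_of_contDiffOn hΓ.smooth_uncurry hΓ.zero_mem hs)

theorem smooth_variationField (hΓ : M.IsVariation I γ a b ε Γ) :
    ContDiffOn ℝ ∞ (variationField Γ) (interior I) :=
  (contDiffOn_dirDeriv isOpen_domain hΓ.smooth_uncurry _).comp (f := fun s : ℝ => ((0 : ℝ), s))
    (by fun_prop) fun _ hs => ⟨hΓ.zero_mem, hs⟩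

theorem deriv_variationField (hΓ : M.IsVariation I γ a b ε Γ) (hs : s ∈ interior I) :
    deriv (variationField Γ) s = dirDeriv (1, 0) (dirDeriv (0, 1) (Function.uncurry Γ)) (0, s) :=
  (hasDerivAt_dirDeriv_fst_snd_slice isOpen_domain hΓ.smooth_uncurry ⟨hΓ.zero_mem, hs⟩).deriv

theorem deriv_deriv_variationField (hΓ : M.IsVariation I γ a b ε Γ) (hs : s ∈ interior I) :
    deriv (deriv (variationField Γ)) s =
      dirDeriv (1, 0) (dirDeriv (0, 1) (dirDeriv (0, 1) (Function.uncurry Γ))) (0, s) := by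
  have heq : deriv (variationField Γ) =ᶠ[𝓝 s]
      fun x => dirDeriv (1, 0) (dirDeriv (0, 1) (Function.uncurry Γ)) (0, x) := by
    filter_upwards [isOpen_interior.mem_nhds hs] with x hx using hΓ.deriv_variationField hx
  rw [heq.deriv_eq]
  exact (hasDerivAt_dirDeriv_fst_snd_slice isOpen_domain hΓ.smooth_velocity
    ⟨hΓ.zero_mem, hs⟩).deriv

theorem eqOn_variationField_zero (hΓ : M.IsVariation I γ a b ε Γ) :
    EqOn (variationField Γ) 0 (interior I \ Icc a b) := by
  intro s hs
  refine (hΓ.hasDerivAt_variationField hs.1).unique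
    ((hasDerivAt_const 0 (γ s)).congr_of_eventuallyEq ?_)
  filter_upwards [Ioo_mem_nhds hΓ.zero_mem.1 hΓ.zero_mem.2] with t ht
  exact hΓ.fixed t ht s ⟨interior_subset hs.1, hs.2⟩

theorem eqOn_deriv_variationField_zero (hΓ : M.IsVariation I γ a b ε Γ) :
    EqOn (deriv (variationField Γ)) 0 (interior I \ Icc a b) := by
  intro s hs
  have hopen : IsOpen (interior I \ Icc a b) := isOpen_interior.sdiff isClosed_Icc
  rw [(hΓ.eqOn_variationField_zero.eventuallyEq_of_mem (hopen.mem_nhds hs)).deriv_eq]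
  exact deriv_const s (0 : V)

variable [FiniteDimensional ℝ V]

theorem variationField_mem (hM : M.IsSpaceForm) (hΓ : M.IsVariation I γ a b ε Γ)
    (hs : s ∈ interior I) : variationField Γ s ∈ M.tangentSpace (γ s) := by
  have hfield := hΓ.hasDerivAt_variationField hs
  have hform := (hasDerivAt_form M hfield hfield).const_mul M.curv
  have hconst : HasDerivAt (fun t => M.curv * M.form (Γ t s) (Γ t s)) 0 0 := by
    refine (hasDerivAt_const 0 (M.curv ^ 2)).congr_of_eventuallyEq ?_
    filter_upwards [Ioo_mem_nhds hΓ.zero_mem.1 hΓ.zero_mem.2] with t ht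
    exact hM.curv_mul_form_self _ (hΓ.mem t ht s (interior_subset hs))
  have h := hform.unique hconst
  rw [hM.symm (variationField Γ s), hΓ.initial s (interior_subset hs)] at h
  rw [mem_tangentSpace]
  linarith

theorem smooth_tensionSq (hΓ : M.IsVariation I γ a b ε Γ) :
    ContDiffOn ℝ ∞ (M.tensionSq Γ) (Ioo (-ε) ε ×ˢ interior I) :=
  (contDiffOn_form M hΓ.smooth_acceleration hΓ.smooth_acceleration).sub
    (contDiffOn_const.mul ((contDiffOn_form M hΓ.smooth_velocity hΓ.smooth_velocity).pow 2))

theorem len_tension (hM : M.IsSpaceForm) (hU : UniqueDiffOn ℝ I) (hΓ : M.IsVariation I γ a b ε Γ)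
    (ht : t ∈ Ioo (-ε) ε) (hs : s ∈ interior I) :
    M.len (M.tension I (Γ t) s) = √(M.tensionSq Γ (t, s)) := by
  have hsmooth : ContDiffOn ℝ ∞ (Γ t) I :=
    hΓ.smooth.comp (f := fun x : ℝ => (t, x)) (by fun_prop) fun x hx => ⟨ht, hx⟩
  have hdiff := hsmooth.differentiableOn (by simp)
  have hdiff' := (hsmooth.derivWithin hU (m := ∞) (by simp)).differentiableOn (by simp)
  have horth : ∀ x ∈ I, M.curv * M.form (Γ t x) (derivWithin (Γ t) I x) = 0 := by
    intro x hx
    have h := form_derivWithin_add_eq_zero hU hdiff hdiff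
      (fun x hx => hM.curv_mul_form_self _ (hΓ.mem t ht x hx)) hx
    rw [hM.symm (derivWithin (Γ t) I x)] at h
    linarith
  have hsI := interior_subset hs
  rw [len, tension, covDeriv, hM.form_tangentProj_self (hΓ.mem t ht s hsI)
    (form_derivWithin_add_eq_zero hU hdiff hdiff' horth hsI), hΓ.derivWithin_eq hU ht hs,
    hΓ.derivWithin_derivWithin_eq hU ht hs, tensionSq]

theorem tensionSq_zero (hM : M.IsSpaceForm) (hU : UniqueDiffOn ℝ I)
    (hγ : M.IsUnitSpeedCurve I γ) (hF : M.IsFrenetFrame I γ k τ N B)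
    (hΓ : M.IsVariation I γ a b ε Γ) (hs : s ∈ interior I) :
    M.tensionSq Γ (0, s) = k s ^ 2 := by
  have hsI := interior_subset hs
  have hN := mem_tangentSpace.1 (hF.normal_mem hM hγ hsI)
  rw [tensionSq, hΓ.velocity_zero hU hs, hΓ.acceleration_zero hU hs, hγ.unit_speed s hsI,
    hF.derivWithin_velocity hM hU hγ hsI]
  simp only [map_sub, map_smul, smul_eq_mul, LinearMap.sub_apply, LinearMap.smul_apply,
    hF.unit_N s hsI, hM.symm (N s) (γ s)]
  linear_combination M.curv * hM.curv_mul_form_self _ (hγ.mem s hsI) + hM.curv_pow_three -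
    2 * k s * hN

theorem hasDerivAt_tensionSq (hM : M.IsSpaceForm) (hU : UniqueDiffOn ℝ I)
    (hγ : M.IsUnitSpeedCurve I γ) (hΓ : M.IsVariation I γ a b ε Γ) (hs : s ∈ interior I) :
    HasDerivAt (fun t => M.tensionSq Γ (t, s))
      (2 * (M.form (derivWithin (derivWithin γ I) I s) (deriv (deriv (variationField Γ)) s) -
        2 * M.curv * M.form (derivWithin γ I s) (deriv (variationField Γ) s))) 0 := by
  have hvel := hasDerivAt_fst_slice
    (differentiableAt_of_contDiffOn hΓ.smooth_velocity hΓ.zero_mem hs)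
  have hacc := hasDerivAt_fst_slice
    (differentiableAt_of_contDiffOn hΓ.smooth_acceleration hΓ.zero_mem hs)
  rw [← hΓ.deriv_variationField hs] at hvel
  rw [← hΓ.deriv_deriv_variationField hs] at hacc
  refine ((hasDerivAt_form M hacc hacc).sub
    (((hasDerivAt_form M hvel hvel).pow 2).const_mul M.curv)).congr_deriv ?_
  rw [hΓ.velocity_zero hU hs, hΓ.acceleration_zero hU hs, hγ.unit_speed s (interior_subset hs),
    hM.symm _ (derivWithin γ I s), hM.symm _ (derivWithin (derivWithin γ I) I s)]
  ring

end IsVariation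

end FirstVariation

section EulerLagrange

variable {V : Type*} [NormedAddCommGroup V] [NormedSpace ℝ V] {M : SpaceFormModel V}
  {I : Set ℝ} {γ N B : ℝ → V} {k τ : ℝ → ℝ} {a b ε p s : ℝ} {Γ : ℝ → ℝ → V}

/-- The normal component of the Euler–Lagrange operator of the `p`-bienergy in curvature `K`,
where `φ = k ^ (p - 1)`. -/
noncomputable def eulerLagrangeNormal (K : ℝ) (k τ φ : ℝ → ℝ) (s : ℝ) : ℝ :=
  deriv (deriv φ) s + (K - k s ^ 2 - τ s ^ 2) * φ s

/-- The binormal component of the Euler–Lagrange operator of the `p`-bienergy, where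
`φ = k ^ (p - 1)`. -/
noncomputable def eulerLagrangeBinormal (τ φ : ℝ → ℝ) (s : ℝ) : ℝ :=
  2 * deriv φ s * τ s + φ s * deriv τ s

/-- The Euler–Lagrange operator of the `p`-bienergy at a Frenet curve, as a tangent field along
the curve, where `φ = k ^ (p - 1)`. -/
noncomputable def eulerLagrangeField (M : SpaceFormModel V) (I : Set ℝ) (γ N B : ℝ → V)
    (k τ φ : ℝ → ℝ) (s : ℝ) : V :=
  eulerLagrangeNormal M.curv k τ φ s • N s + eulerLagrangeBinormal τ φ s • B s -
    (2 * deriv φ s * k s + φ s * deriv k s) • derivWithin γ I s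

/-- The Ostrogradsky momentum `∂L/∂v - d/ds (∂L/∂a)` of the second order Lagrangian
`L(v, a) = (1/p) (⟨a, a⟩ - K ⟨v, v⟩²) ^ (p/2)` of the `p`-bienergy, at a Frenet curve, where
`φ = k ^ (p - 1)` and `g = k ^ (p - 2)`. -/
noncomputable def momentum (M : SpaceFormModel V) (I : Set ℝ) (γ N B : ℝ → V)
    (k τ φ g : ℝ → ℝ) (s : ℝ) : V :=
  (φ s * k s - M.curv * g s) • derivWithin γ I s - deriv φ s • N s - (φ s * τ s) • B s +
    (M.curv * deriv g s) • γ s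

variable [FiniteDimensional ℝ V]

namespace IsFrenetFrame

variable (hM : M.IsSpaceForm) (hU : UniqueDiffOn ℝ I) (hγ : M.IsUnitSpeedCurve I γ)
  (hF : M.IsFrenetFrame I γ k τ N B)

include hM hU hγ hF

theorem hasDerivAt_frame (hs : s ∈ interior I) :
    HasDerivAt (derivWithin γ I) (k s • N s - M.curv • γ s) s ∧
      HasDerivAt N (-(k s) • derivWithin γ I s + τ s • B s) s ∧
      HasDerivAt B (-(τ s) • N s) s := by
  have hsI := interior_subset hs
  rw [← hF.derivWithin_velocity hM hU hγ hsI, ← hF.derivWithin_normal hM hU hγ hsI,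
    ← hF.derivWithin_binormal hM hU hγ hsI]
  exact ⟨hasDerivAt_derivWithin_of_mem_interior
      ((hγ.smooth_velocity hU).differentiableOn (by simp)) hs,
    hasDerivAt_derivWithin_of_mem_interior (hF.smooth_N.differentiableOn (by simp)) hs,
    hasDerivAt_derivWithin_of_mem_interior (hF.smooth_B.differentiableOn (by simp)) hs⟩

theorem smooth_eulerLagrangeField {φ : ℝ → ℝ} (hφ : ContDiffOn ℝ ∞ φ (interior I)) :
    ContDiffOn ℝ ∞ (M.eulerLagrangeField I γ N B k τ φ) (interior I) := by
  have hk := (hF.smooth_curvature hM hU hγ).mono interior_subset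
  have hτ := (hF.smooth_torsion hM hU hγ).mono interior_subset
  have hφ' := contDiffOn_deriv_of_isOpen isOpen_interior hφ
  have hφ'' := contDiffOn_deriv_of_isOpen isOpen_interior hφ'
  have hk' := contDiffOn_deriv_of_isOpen isOpen_interior hk
  have hτ' := contDiffOn_deriv_of_isOpen isOpen_interior hτ
  exact (((hφ''.add (((contDiffOn_const.sub (hk.pow 2)).sub (hτ.pow 2)).mul hφ)).smul
    (hF.smooth_N.mono interior_subset)).add ((((contDiffOn_const.mul hφ').mul hτ).add
      (hφ.mul hτ')).smul (hF.smooth_B.mono interior_subset))).sub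
    ((((contDiffOn_const.mul hφ').mul hk).add (hφ.mul hk')).smul
      ((hγ.smooth_velocity hU).mono interior_subset))

variable {φ g : ℝ → ℝ} (hφ : ContDiffOn ℝ ∞ φ (interior I)) (hg : ContDiffOn ℝ ∞ g (interior I))

include hφ hg

theorem hasDerivAt_smul_normal_sub_smul (hs : s ∈ interior I) :
    HasDerivAt (fun s => φ s • N s - (M.curv * g s) • γ s)
      (-(M.momentum I γ N B k τ φ g s) - (2 * M.curv * g s) • derivWithin γ I s) s := by
  obtain ⟨-, hN, -⟩ := hF.hasDerivAt_frame hM hU hγ hs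
  have hγ' := hasDerivAt_derivWithin_of_mem_interior (hγ.smooth.differentiableOn (by simp)) hs
  have hφ' := hasDerivAt_deriv_of_contDiffOn isOpen_interior hφ hs
  have hg' := hasDerivAt_deriv_of_contDiffOn isOpen_interior hg hs
  refine ((hφ'.smul hN).sub ((hg'.const_mul M.curv).smul hγ')).congr_deriv ?_
  rw [momentum]
  module

theorem hasDerivAt_momentum (hgk : ∀ s ∈ interior I, g s * k s = φ s) (hs : s ∈ interior I) :
    HasDerivAt (M.momentum I γ N B k τ φ g) (-(M.eulerLagrangeField I γ N B k τ φ s -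
      (M.curv * (deriv (deriv g) s + M.curv * g s - φ s * k s)) • γ s)) s := by
  have hJ : IsOpen (interior I) := isOpen_interior
  obtain ⟨hT, hN, hB⟩ := hF.hasDerivAt_frame hM hU hγ hs
  have hγ' := hasDerivAt_derivWithin_of_mem_interior (hγ.smooth.differentiableOn (by simp)) hs
  have hφ' := hasDerivAt_deriv_of_contDiffOn hJ hφ hs
  have hφ'' := hasDerivAt_deriv_of_contDiffOn hJ (contDiffOn_deriv_of_isOpen hJ hφ) hs
  have hg' := hasDerivAt_deriv_of_contDiffOn hJ hg hs
  have hg'' := hasDerivAt_deriv_of_contDiffOn hJ (contDiffOn_deriv_of_isOpen hJ hg) hs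
  have hk' := hasDerivAt_deriv_of_contDiffOn hJ
    ((hF.smooth_curvature hM hU hγ).mono interior_subset) hs
  have hτ' := hasDerivAt_deriv_of_contDiffOn hJ
    ((hF.smooth_torsion hM hU hγ).mono interior_subset) hs
  refine ((((((hφ'.mul hk').sub (hg'.const_mul M.curv)).smul hT).sub (hφ''.smul hN)).sub
    ((hφ'.mul hτ').smul hB)).add ((hg''.const_mul M.curv).smul hγ')).congr_deriv ?_
  simp only [eulerLagrangeField, eulerLagrangeNormal, eulerLagrangeBinormal, ← hgk s hs,
    Pi.sub_apply, Pi.mul_apply]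
  module

end IsFrenetFrame

namespace IsVariation

variable (hM : M.IsSpaceForm) (hU : UniqueDiffOn ℝ I) (hΓ : M.IsVariation I γ a b ε Γ)

include hΓ

omit [FiniteDimensional ℝ V] in
theorem uIcc_subset_interior : uIcc a b ⊆ interior I := by
  rw [uIcc_of_le hΓ.lt.le]
  exact hΓ.subset

include hM hU

theorem pBienergy_eq {t : ℝ} (ht : t ∈ Ioo (-ε) ε)
    (hpos : ∀ s ∈ uIcc a b, 0 ≤ M.tensionSq Γ (t, s)) :
    M.pBienergy p I a b (Γ t) = ∫ s in a..b, 1 / p * M.tensionSq Γ (t, s) ^ (p / 2) := by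
  rw [pBienergy, ← intervalIntegral.integral_const_mul]
  refine intervalIntegral.integral_congr fun s hs => ?_
  rw [hΓ.len_tension hM hU ht (hΓ.uIcc_subset_interior hs), Real.sqrt_eq_rpow,
    ← Real.rpow_mul (hpos s hs), one_div_mul_eq_div (2 : ℝ)]

variable (hγ : M.IsUnitSpeedCurve I γ) (hF : M.IsFrenetFrame I γ k τ N B)

include hγ hF

theorem hasDerivAt_tensionSq_rpow (hp : p ≠ 0) (hs : s ∈ interior I) :
    HasDerivAt (fun t => 1 / p * M.tensionSq Γ (t, s) ^ (p / 2))
      (k s ^ (p - 2) *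
        (M.form (derivWithin (derivWithin γ I) I s) (deriv (deriv (variationField Γ)) s) -
          2 * M.curv * M.form (derivWithin γ I s) (deriv (variationField Γ) s))) 0 := by
  have hk := hF.k_pos s (interior_subset hs)
  have hsq := hΓ.tensionSq_zero hM hU hγ hF hs
  refine (((hΓ.hasDerivAt_tensionSq hM hU hγ hs).rpow_const (p := p / 2)
    (Or.inl (by rw [hsq]; positivity))).const_mul (1 / p)).congr_deriv ?_
  have hpow : (k s ^ 2) ^ (p / 2 - 1) = k s ^ (p - 2) := by
    rw [← Real.rpow_natCast, ← Real.rpow_mul hk.le]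
    congr 1
    push_cast
    ring
  rw [hsq, hpow]
  field_simp

theorem hasDerivAt_pBienergy (hp : p ≠ 0) :
    HasDerivAt (fun t => M.pBienergy p I a b (Γ t))
      (∫ s in a..b, k s ^ (p - 2) *
        (M.form (derivWithin (derivWithin γ I) I s) (deriv (deriv (variationField Γ)) s) -
          2 * M.curv * M.form (derivWithin γ I s) (deriv (variationField Γ) s))) 0 := by
  have hsub := hΓ.uIcc_subset_interior
  set U := (Ioo (-ε) ε ×ˢ interior I) ∩ M.tensionSq Γ ⁻¹' Ioi 0
  have hUopen : IsOpen U :=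
    hΓ.smooth_tensionSq.continuousOn.isOpen_inter_preimage isOpen_domain isOpen_Ioi
  have hzeroU : {(0 : ℝ)} ×ˢ uIcc a b ⊆ U := by
    rintro ⟨t, s⟩ ⟨rfl, hs⟩
    refine ⟨⟨hΓ.zero_mem, hsub hs⟩, ?_⟩
    rw [mem_preimage, hΓ.tensionSq_zero hM hU hγ hF (hsub hs)]
    exact pow_pos (hF.k_pos s (interior_subset (hsub hs))) 2
  have hsmooth : ContDiffOn ℝ ∞ (fun q => 1 / p * M.tensionSq Γ q ^ (p / 2)) U :=
    contDiffOn_const.mul ((hΓ.smooth_tensionSq.mono inter_subset_left).rpow_const_of_ne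
      fun q hq => hq.2.ne')
  have hintegral := hasDerivAt_intervalIntegral_of_contDiffOn hUopen
    (hsmooth.of_le ENat.LEInfty.out) hzeroU
  obtain ⟨u, v, hu, -, h0u, hv, huv⟩ :=
    generalized_tube_lemma isCompact_singleton isCompact_uIcc hUopen hzeroU
  have henergy : (fun t => M.pBienergy p I a b (Γ t)) =ᶠ[𝓝 0]
      fun t => ∫ s in a..b, 1 / p * M.tensionSq Γ (t, s) ^ (p / 2) := by
    filter_upwards [Ioo_mem_nhds hΓ.zero_mem.1 hΓ.zero_mem.2, hu.mem_nhds (h0u rfl)] with t ht htu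
    exact hΓ.pBienergy_eq hM hU ht fun s hs => (huv ⟨htu, hv hs⟩).2.le
  refine (hintegral.congr_of_eventuallyEq henergy).congr_deriv
    (intervalIntegral.integral_congr fun s hs => ?_)
  have hdiff := (hsmooth.differentiableOn (by simp)).differentiableAt
    (hUopen.mem_nhds (hzeroU (mk_mem_prod rfl hs)))
  exact (hasDerivAt_fst_slice hdiff).unique
    (hΓ.hasDerivAt_tensionSq_rpow hM hU hγ hF hp (hsub hs))

theorem integral_form_eulerLagrangeField {φ g : ℝ → ℝ} (hφ : ContDiffOn ℝ ∞ φ (interior I))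
    (hg : ContDiffOn ℝ ∞ g (interior I)) (hgk : ∀ s ∈ interior I, g s * k s = φ s) :
    ∫ s in a..b, g s *
        (M.form (derivWithin (derivWithin γ I) I s) (deriv (deriv (variationField Γ)) s) -
          2 * M.curv * M.form (derivWithin γ I s) (deriv (variationField Γ) s)) =
      ∫ s in a..b, M.form (M.eulerLagrangeField I γ N B k τ φ s) (variationField Γ s) := by
  have hJ : IsOpen (interior I) := isOpen_interior
  have hsub := hΓ.uIcc_subset_interior
  have hX := hΓ.smooth_variationField
  have hX' := contDiffOn_deriv_of_isOpen hJ hX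
  have hzero := eqOn_zero_sdiff_Ioo_of_eqOn_zero_sdiff_Icc hJ hX.continuousOn
    hΓ.eqOn_variationField_zero
  have hzero' := eqOn_zero_sdiff_Ioo_of_eqOn_zero_sdiff_Icc hJ hX'.continuousOn
    hΓ.eqOn_deriv_variationField_zero
  have ha : a ∈ interior I \ Ioo a b := ⟨hsub left_mem_uIcc, fun h => h.1.false⟩
  have hb : b ∈ interior I \ Ioo a b := ⟨hsub right_mem_uIcc, fun h => h.2.false⟩
  have hcγ := hγ.smooth.continuousOn.mono (interior_subset (s := I))
  have hcT := (hγ.smooth_velocity hU).continuousOn.mono (interior_subset (s := I))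
  have hcE := (hF.smooth_eulerLagrangeField hM hU hγ hφ).continuousOn
  have hcg'' := (contDiffOn_deriv_of_isOpen hJ (contDiffOn_deriv_of_isOpen hJ hg)).continuousOn
  have hck := (hF.smooth_curvature hM hU hγ).continuousOn.mono (interior_subset (s := I))
  have hparts := integral_form_sub_form_deriv_eq M
    (fun s hs => hF.hasDerivAt_smul_normal_sub_smul hM hU hγ hφ hg (hsub hs))
    (fun s hs => hF.hasDerivAt_momentum hM hU hγ hφ hg hgk (hsub hs))
    (fun s hs => hasDerivAt_deriv_of_contDiffOn hJ hX (hsub hs))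
    (fun s hs => hasDerivAt_deriv_of_contDiffOn hJ hX' (hsub hs))
    ((contDiffOn_deriv_of_isOpen hJ hX').continuousOn.mono hsub)
    (((continuousOn_const.mul hg.continuousOn).smul hcT).mono hsub)
    ((hcE.sub ((continuousOn_const.mul ((hcg''.add (continuousOn_const.mul hg.continuousOn)).sub
      (hφ.continuousOn.mul hck))).smul hcγ)).mono hsub) (hzero ha) (hzero' ha) (hzero hb)
      (hzero' hb)
  refine Eq.trans (intervalIntegral.integral_congr fun s hs => ?_)
    (hparts.trans (intervalIntegral.integral_congr fun s hs => ?_))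
  · rw [hF.derivWithin_velocity hM hU hγ (interior_subset (hsub hs)), ← hgk s (hsub hs)]
    simp only [map_sub, map_smul, LinearMap.sub_apply, LinearMap.smul_apply, smul_eq_mul]
    ring
  · have htangent := mem_tangentSpace.1 (hΓ.variationField_mem hM (hsub hs))
    simp only [map_sub, map_smul, LinearMap.sub_apply, LinearMap.smul_apply, smul_eq_mul]
    linear_combination (-(deriv (deriv g) s + M.curv * g s - φ s * k s)) * htangent

theorem hasDerivAt_pBienergy_eulerLagrangeField (hp : p ≠ 0) :
    HasDerivAt (fun t => M.pBienergy p I a b (Γ t))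
      (∫ s in a..b, M.form (M.eulerLagrangeField I γ N B k τ (fun s => k s ^ (p - 1)) s)
        (variationField Γ s)) 0 := by
  have hkpos : ∀ s ∈ interior I, k s ≠ 0 := fun s hs => (hF.k_pos s (interior_subset hs)).ne'
  have hrpow : ∀ r : ℝ, ContDiffOn ℝ ∞ (fun s => k s ^ r) (interior I) := fun r =>
    ((hF.smooth_curvature hM hU hγ).mono interior_subset).rpow_const_of_ne hkpos
  rw [← hΓ.integral_form_eulerLagrangeField hM hU hγ hF (hrpow (p - 1)) (hrpow (p - 2))
    fun s hs => by rw [← Real.rpow_add_one (hkpos s hs)]; ring_nf]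
  exact hΓ.hasDerivAt_pBienergy hM hU hγ hF hp

end IsVariation

end EulerLagrange

section CriticalPoints

variable {V : Type*} [NormedAddCommGroup V] [NormedSpace ℝ V] {M : SpaceFormModel V}
  {I : Set ℝ} {γ N B e : ℝ → V} {k τ : ℝ → ℝ} {p : ℝ}

/-- The variation of `γ` in the direction of the unit tangent field `e` with amplitude `f`, brought
back to the space form by radial projection. -/
noncomputable def radialVariation (M : SpaceFormModel V) (γ e : ℝ → V) (f : ℝ → ℝ) (t s : ℝ) : V :=
  (√(1 + M.curv * (t * f s) ^ 2))⁻¹ • (γ s + (t * f s) • e s)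

theorem hasDerivAt_radialVariation (γ e : ℝ → V) (f : ℝ → ℝ) (s : ℝ) :
    HasDerivAt (fun t => M.radialVariation γ e f t s) (f s • e s) 0 := by
  have hamplitude : HasDerivAt (fun t : ℝ => t * f s) (f s) 0 := hasDerivAt_mul_const (f s)
  have hscale := ((((hamplitude.pow 2).const_mul M.curv).const_add 1).sqrt (by simp)).inv (by simp)
  refine (hscale.smul ((hamplitude.smul_const (e s)).const_add (γ s))).congr_deriv ?_
  simp

theorem IsSpaceForm.one_add_curv_mul_sq_pos (hM : M.IsSpaceForm) {x : ℝ} (hx : |x| < 1) :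
    0 < 1 + M.curv * x ^ 2 := by
  have hx' : x ^ 2 < 1 := (sq_lt_one_iff_abs_lt_one x).2 hx
  rcases hM.curv_cases with h | h | h <;> rw [h] <;> nlinarith [sq_nonneg x]

theorem abs_mul_contDiffBump_lt_one {c t : ℝ} (f : ContDiffBump c) (ht : t ∈ Ioo (-1 : ℝ) 1)
    (s : ℝ) : |t * f s| < 1 := by
  rw [abs_mul, abs_of_nonneg f.nonneg]
  exact mul_lt_one_of_nonneg_of_lt_one_left (abs_nonneg t) (abs_lt.2 ht) f.le_one

theorem radialVariation_mem (hM : M.IsSpaceForm) {x : ℝ → ℝ} {s t : ℝ} (hγ : γ s ∈ M.carrier)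
    (he : e s ∈ M.tangentSpace (γ s)) (heu : M.form (e s) (e s) = 1)
    (hpos : 0 < 1 + M.curv * (t * x s) ^ 2) : M.radialVariation γ e x t s ∈ M.carrier := by
  have hsq : M.form ((t * x s) • e s) ((t * x s) • e s) = (t * x s) ^ 2 := by
    simp only [map_smul, LinearMap.smul_apply, heu, smul_eq_mul]
    ring
  rw [radialVariation, ← hsq]
  exact hM.normalize_mem _ hγ _ (Submodule.smul_mem _ _ he) (by rwa [hsq])

theorem isVariation_radialVariation (hM : M.IsSpaceForm) (hγ : M.IsUnitSpeedCurve I γ)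
    (he : ContDiffOn ℝ ∞ e I) (het : ∀ s ∈ I, e s ∈ M.tangentSpace (γ s))
    (heu : ∀ s ∈ I, M.form (e s) (e s) = 1) {c : ℝ} (f : ContDiffBump c)
    (hsub : Icc (c - f.rOut) (c + f.rOut) ⊆ interior I) :
    M.IsVariation I γ (c - f.rOut) (c + f.rOut) 1 (M.radialVariation γ e f) where
  eps_pos := one_pos
  lt := by linarith [f.rOut_pos]
  subset := hsub
  smooth := by
    have hamplitude : ContDiff ℝ ∞ fun q : ℝ × ℝ => q.1 * f q.2 :=
      contDiff_fst.mul (f.contDiff.comp contDiff_snd)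
    have hpos : ∀ q ∈ Ioo (-1 : ℝ) 1 ×ˢ I, 0 < 1 + M.curv * (q.1 * f q.2) ^ 2 := fun q hq =>
      hM.one_add_curv_mul_sq_pos (abs_mul_contDiffBump_lt_one f hq.1 q.2)
    have hscale : ContDiff ℝ ∞ fun q : ℝ × ℝ => 1 + M.curv * (q.1 * f q.2) ^ 2 :=
      contDiff_const.add (contDiff_const.mul (hamplitude.pow 2))
    have hsnd : MapsTo Prod.snd (Ioo (-1 : ℝ) 1 ×ˢ I) I := fun q hq => hq.2
    exact ((hscale.contDiffOn.sqrt fun q hq => (hpos q hq).ne').inv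
      fun q hq => (Real.sqrt_pos.2 (hpos q hq)).ne').smul
      ((hγ.smooth.comp contDiff_snd.contDiffOn hsnd).add
        (hamplitude.contDiffOn.smul (he.comp contDiff_snd.contDiffOn hsnd)))
  mem t ht s hs := radialVariation_mem hM (hγ.mem s hs) (het s hs) (heu s hs)
    (hM.one_add_curv_mul_sq_pos (abs_mul_contDiffBump_lt_one f ht s))
  initial s _ := by simp [radialVariation]
  fixed t _ s hs := by
    have hzero : f s = 0 := f.zero_of_le_dist <| by
      rw [← not_lt, ← Metric.mem_ball, Real.ball_eq_Ioo]
      exact fun h => hs.2 (Ioo_subset_Icc_self h)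
    simp [radialVariation, hzero]

variable [FiniteDimensional ℝ V]

variable (hM : M.IsSpaceForm) (hU : UniqueDiffOn ℝ I) (hγ : M.IsUnitSpeedCurve I γ)
  (hF : M.IsFrenetFrame I γ k τ N B)

include hM hU hγ hF

theorem IsPBiharmonic.form_eulerLagrangeField_eq_zero (hcrit : M.IsPBiharmonic p I γ) (hp : p ≠ 0)
    (he : ContDiffOn ℝ ∞ e I) (het : ∀ s ∈ I, e s ∈ M.tangentSpace (γ s))
    (heu : ∀ s ∈ I, M.form (e s) (e s) = 1) {s : ℝ} (hs : s ∈ interior I) :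
    M.form (M.eulerLagrangeField I γ N B k τ (fun s => k s ^ (p - 1)) s) (e s) = 0 := by
  have hrpow : ContDiffOn ℝ ∞ (fun s => k s ^ (p - 1)) (interior I) :=
    ((hF.smooth_curvature hM hU hγ).mono interior_subset).rpow_const_of_ne
      fun s hs => (hF.k_pos s (interior_subset hs)).ne'
  refine eq_zero_of_integral_mul_contDiffBump_eq_zero isOpen_interior
    (f := fun s => M.form (M.eulerLagrangeField I γ N B k τ (fun s => k s ^ (p - 1)) s) (e s))
    (continuousOn_form M (hF.smooth_eulerLagrangeField hM hU hγ hrpow).continuousOn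
      (he.continuousOn.mono interior_subset)) (fun c f hsub => ?_) hs
  have hΓ := isVariation_radialVariation hM hγ he het heu f hsub
  rw [← (hΓ.hasDerivAt_pBienergy_eulerLagrangeField hM hU hγ hF hp).unique (hcrit _ _ _ _ hΓ)]
  refine intervalIntegral.integral_congr fun s hs => ?_
  rw [(hΓ.hasDerivAt_variationField (hΓ.uIcc_subset_interior hs)).unique
    (hasDerivAt_radialVariation γ e f s), map_smul, smul_eq_mul, mul_comm]

theorem IsFrenetFrame.isPBiharmonic_iff (hp : p ≠ 0) : M.IsPBiharmonic p I γ ↔ ∀ s ∈ interior I,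
    eulerLagrangeNormal M.curv k τ (fun s => k s ^ (p - 1)) s = 0 ∧
      eulerLagrangeBinormal τ (fun s => k s ^ (p - 1)) s = 0 ∧
        2 * deriv (fun s => k s ^ (p - 1)) s * k s + k s ^ (p - 1) * deriv k s = 0 := by
  constructor
  · intro hcrit s hs
    have hsI := interior_subset hs
    have hT := hcrit.form_eulerLagrangeField_eq_zero hM hU hγ hF hp (hγ.smooth_velocity hU)
      (fun s hs => hγ.velocity_mem hM hU hs) hγ.unit_speed hs
    have hN := hcrit.form_eulerLagrangeField_eq_zero hM hU hγ hF hp hF.smooth_N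
      (fun s hs => hF.normal_mem hM hγ hs) hF.unit_N hs
    have hB := hcrit.form_eulerLagrangeField_eq_zero hM hU hγ hF hp hF.smooth_B
      (fun s hs => hF.binormal_mem hM hγ hs) hF.unit_B hs
    simp only [eulerLagrangeField, map_sub, map_add, map_smul, LinearMap.sub_apply,
      LinearMap.add_apply, LinearMap.smul_apply, hM.symm (N s) (derivWithin γ I s),
      hM.symm (B s), hF.unit_N s hsI, hF.unit_B s hsI, hF.orth_TN s hsI, hF.orth_TB s hsI,
      hF.orth_NB s hsI, hγ.unit_speed s hsI, smul_eq_mul, mul_zero, mul_one, add_zero, zero_add,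
      sub_zero, zero_sub, neg_eq_zero] at hT hN hB
    exact ⟨hN, hB, hT⟩
  · intro hzero a b ε Γ hΓ
    refine (hΓ.hasDerivAt_pBienergy_eulerLagrangeField hM hU hγ hF hp).congr_deriv ?_
    rw [intervalIntegral.integral_congr (g := fun _ => (0 : ℝ)) fun s hs => ?_,
      intervalIntegral.integral_zero]
    obtain ⟨hN, hB, hT⟩ := hzero s (hΓ.uIcc_subset_interior hs)
    simp [eulerLagrangeField, hN, hB, hT]

end CriticalPoints

section HalfEulerLagrange

variable {J : Set ℝ} {k τ φ u u' v v' : ℝ → ℝ} {K b C s : ℝ}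

theorem two_mul_deriv_rpow_mul_add (hk : DifferentiableAt ℝ k s) (hpos : 0 < k s) (p : ℝ) :
    2 * deriv (fun x => k x ^ (p - 1)) s * k s + k s ^ (p - 1) * deriv k s =
      (2 * p - 1) * k s ^ (p - 1) * deriv k s := by
  have hmul : k s ^ (p - 1 - 1) * k s = k s ^ (p - 1) := by
    rw [← Real.rpow_add_one hpos.ne', sub_add_cancel]
  rw [(hk.hasDerivAt.rpow_const (Or.inl hpos.ne')).deriv]
  linear_combination 2 * (p - 1) * deriv k s * hmul

theorem eulerLagrangeBinormal_eq_zero_iff (hJ : IsOpen J) (hJc : IsPreconnected J)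
    (hφ : ContDiffOn ℝ ∞ φ J) (hφ0 : ∀ s ∈ J, φ s ≠ 0) (hτ : ContDiffOn ℝ ∞ τ J) :
    (∀ s ∈ J, eulerLagrangeBinormal τ φ s = 0) ↔ ∃ b, ∀ s ∈ J, φ s ^ 2 * τ s = b := by
  have hderiv : ∀ s ∈ J,
      HasDerivAt (fun s => φ s ^ 2 * τ s) (φ s * eulerLagrangeBinormal τ φ s) s := fun s hs =>
    (((hasDerivAt_deriv_of_contDiffOn hJ hφ hs).fun_pow 2).mul
      (hasDerivAt_deriv_of_contDiffOn hJ hτ hs)).congr_deriv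
        (by simp only [eulerLagrangeBinormal, Nat.cast_ofNat]; ring)
  constructor
  · intro h
    exact exists_eq_const_of_hasDerivAt_zero hJ hJc fun s hs =>
      (hderiv s hs).congr_deriv (by rw [h s hs, mul_zero])
  · rintro ⟨b, hb⟩ s hs
    have hconst : HasDerivAt (fun s => φ s ^ 2 * τ s) 0 s :=
      (hasDerivAt_const s b).congr_of_eventuallyEq (eventually_of_mem (hJ.mem_nhds hs) hb)
    exact (mul_eq_zero.1 ((hderiv s hs).unique hconst)).resolve_left (hφ0 s hs)

theorem eulerLagrangeNormal_eq_ermakov (hφ : φ s ≠ 0) (hk : k s = (φ s ^ 2)⁻¹)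
    (hτ : τ s = b * k s) :
    eulerLagrangeNormal K k τ φ s = deriv (deriv φ) s + K * φ s - (1 + b ^ 2) / φ s ^ 3 := by
  rw [eulerLagrangeNormal, hτ, hk]
  field_simp
  ring

/-- The radius of curvature `u` of a `1/2`-biharmonic curve of torsion `b / u` in curvature `K`,
together with its derivative `u'`, as a solution of `u'' = 2 C - 4 K u` whose initial values are
tied to the constant `C`. -/
structure IsCurvatureRadius (K b C : ℝ) (J : Set ℝ) (u u' : ℝ → ℝ) : Prop where
  hasDerivAt : ∀ s ∈ J, HasDerivAt u (u' s) s
  hasDerivAt_deriv : ∀ s ∈ J, HasDerivAt u' (2 * C - 4 * K * u s) s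
  deriv_sq : ∀ s ∈ J, u' s ^ 2 = 4 * C * u s - 4 * (1 + b ^ 2) - 4 * K * u s ^ 2

theorem IsCurvatureRadius.congr (h : IsCurvatureRadius K b C J u u') (hJ : IsOpen J)
    (huv : EqOn v u J) (huv' : EqOn v' u' J) : IsCurvatureRadius K b C J v v' where
  hasDerivAt s hs := by
    rw [huv' hs]
    exact (h.hasDerivAt s hs).congr_of_eventuallyEq (eventually_of_mem (hJ.mem_nhds hs) huv)
  hasDerivAt_deriv s hs := by
    rw [huv hs]
    exact (h.hasDerivAt_deriv s hs).congr_of_eventuallyEq (eventually_of_mem (hJ.mem_nhds hs) huv')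
  deriv_sq s hs := by
    rw [huv hs, huv' hs]
    exact h.deriv_sq s hs

theorem exists_ermakov_first_integral {φ' : ℝ → ℝ} {a : ℝ} (hJ : IsOpen J)
    (hJc : IsPreconnected J) (hφ0 : ∀ s ∈ J, φ s ≠ 0) (hφ : ∀ s ∈ J, HasDerivAt φ (φ' s) s)
    (hφ' : ∀ s ∈ J, HasDerivAt φ' (a / φ s ^ 3 - K * φ s) s) :
    ∃ C, ∀ s ∈ J, φ' s ^ 2 + K * φ s ^ 2 + a / φ s ^ 2 = C := by
  refine exists_eq_const_of_hasDerivAt_zero hJ hJc fun s hs => ?_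
  have hne := hφ0 s hs
  have hd_sq := (hφ s hs).fun_pow 2
  refine ((((hφ' s hs).fun_pow 2).add (hd_sq.const_mul K)).add
    ((hasDerivAt_const s a).div hd_sq (pow_ne_zero 2 hne))).congr_deriv ?_
  field_simp
  ring

theorem eulerLagrangeNormal_eq_zero_iff (hJ : IsOpen J) (hJc : IsPreconnected J)
    (hφ : ContDiffOn ℝ ∞ φ J) (hφ0 : ∀ s ∈ J, φ s ≠ 0) (hk : ∀ s ∈ J, k s = (φ s ^ 2)⁻¹)
    (hτ : ∀ s ∈ J, τ s = b * k s) : (∀ s ∈ J, eulerLagrangeNormal K k τ φ s = 0) ↔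
      ∃ C u', IsCurvatureRadius K b C J (fun s => φ s ^ 2) u' := by
  have hd := fun s (hs : s ∈ J) => hasDerivAt_deriv_of_contDiffOn hJ hφ hs
  have hdd := fun s (hs : s ∈ J) =>
    hasDerivAt_deriv_of_contDiffOn hJ (contDiffOn_deriv_of_isOpen hJ hφ) hs
  have hd_sq : ∀ s ∈ J, HasDerivAt (fun s => φ s ^ 2) (2 * φ s * deriv φ s) s := fun s hs =>
    ((hd s hs).fun_pow 2).congr_deriv (by simp)
  have hdd_sq : ∀ s ∈ J, HasDerivAt (fun s => 2 * φ s * deriv φ s)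
      (2 * deriv φ s ^ 2 + 2 * φ s * deriv (deriv φ) s) s := fun s hs =>
    (((hd s hs).const_mul 2).mul (hdd s hs)).congr_deriv (by ring)
  have hnormal := fun s (hs : s ∈ J) =>
    eulerLagrangeNormal_eq_ermakov (K := K) (hφ0 s hs) (hk s hs) (hτ s hs)
  constructor
  · intro h
    have hode : ∀ s ∈ J, deriv (deriv φ) s = (1 + b ^ 2) / φ s ^ 3 - K * φ s := fun s hs => by
      linear_combination h s hs - hnormal s hs
    obtain ⟨C, hC⟩ := exists_ermakov_first_integral hJ hJc hφ0 hd
      fun s hs => (hdd s hs).congr_deriv (hode s hs)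
    refine ⟨C, _, hd_sq, fun s hs => (hdd_sq s hs).congr_deriv ?_, fun s hs => ?_⟩
    · have hne := hφ0 s hs
      rw [hode s hs, ← hC s hs]
      field_simp
      ring
    · have hne := hφ0 s hs
      rw [← hC s hs]
      field_simp
      ring
  · rintro ⟨C, u', hu⟩ s hs
    have hC := hu.congr hJ (fun _ _ => rfl) fun s hs =>
      (hd_sq s hs).unique (hu.hasDerivAt s hs)
    have hode := (hdd_sq s hs).unique (hC.hasDerivAt_deriv s hs)
    have hne := hφ0 s hs
    rw [hnormal s hs]
    field_simp
    linear_combination φ s ^ 2 / 2 * hode - hC.deriv_sq s hs / 4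

/-- The `p`-bienergy has `φ = k ^ (p - 1)`, so that `φ ^ 2 = k⁻¹` for `p = 1 / 2`. -/
theorem eulerLagrange_half_eq_zero_iff (hJ : IsOpen J) (hJc : IsPreconnected J)
    (hk : ContDiffOn ℝ ∞ k J) (hk0 : ∀ s ∈ J, 0 < k s) (hτ : ContDiffOn ℝ ∞ τ J) :
    (∀ s ∈ J, eulerLagrangeNormal K k τ (fun s => k s ^ ((1 : ℝ) / 2 - 1)) s = 0 ∧
      eulerLagrangeBinormal τ (fun s => k s ^ ((1 : ℝ) / 2 - 1)) s = 0) ↔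
    ∃ b C, (∀ s ∈ J, τ s = b * k s) ∧ ∃ u', IsCurvatureRadius K b C J (fun s => (k s)⁻¹) u' := by
  set φ : ℝ → ℝ := fun s => k s ^ ((1 : ℝ) / 2 - 1)
  have hφ : ContDiffOn ℝ ∞ φ J := hk.rpow_const_of_ne fun s hs => (hk0 s hs).ne'
  have hφ0 : ∀ s ∈ J, φ s ≠ 0 := fun s hs => (Real.rpow_pos_of_pos (hk0 s hs) _).ne'
  have hφ_sq : ∀ s ∈ J, (k s)⁻¹ = φ s ^ 2 := fun s hs => by
    rw [← Real.rpow_mul_natCast (hk0 s hs).le, ← Real.rpow_neg_one]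
    norm_num
  have hk_inv : ∀ s ∈ J, k s = (φ s ^ 2)⁻¹ := fun s hs => by
    rw [← hφ_sq s hs, inv_inv]
  have htorsion : ∀ b, (∀ s ∈ J, φ s ^ 2 * τ s = b) ↔ ∀ s ∈ J, τ s = b * k s := fun b =>
    forall₂_congr fun s hs => by
      rw [hk_inv s hs, ← div_eq_mul_inv, eq_div_iff (pow_ne_zero 2 (hφ0 s hs)), mul_comm]
  have hradius : ∀ b C, (∃ u', IsCurvatureRadius K b C J (fun s => (k s)⁻¹) u') ↔
      ∃ u', IsCurvatureRadius K b C J (fun s => φ s ^ 2) u' := fun b C =>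
    exists_congr fun u' => ⟨fun h => h.congr hJ (fun s hs => (hφ_sq s hs).symm) fun _ _ => rfl,
      fun h => h.congr hJ hφ_sq fun _ _ => rfl⟩
  simp only [forall₂_and, eulerLagrangeBinormal_eq_zero_iff hJ hJc hφ hφ0 hτ, htorsion, hradius]
  constructor
  · rintro ⟨hN, b, hb⟩
    obtain ⟨C, hC⟩ := (eulerLagrangeNormal_eq_zero_iff hJ hJc hφ hφ0 hk_inv hb).1 hN
    exact ⟨b, C, hb, hC⟩
  · rintro ⟨b, C, hb, hC⟩
    exact ⟨(eulerLagrangeNormal_eq_zero_iff hJ hJc hφ hφ0 hk_inv hb).2 ⟨C, hC⟩, b, hb⟩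

namespace IsCurvatureRadius

variable (h : IsCurvatureRadius K b C J u u')

include h

theorem sq_eq_of_eqOn_const {c : ℝ} (hJ : IsOpen J) (hne : J.Nonempty) (hc : ∀ s ∈ J, u s = c) :
    C ^ 2 = 4 * K * (1 + b ^ 2) := by
  obtain ⟨s, hs⟩ := hne
  have hconst : IsCurvatureRadius K b C J (fun _ => c) (fun _ => 0) :=
    h.congr hJ (fun s hs => (hc s hs).symm) fun s hs =>
      ((hasDerivAt_const s c).congr_of_eventuallyEq
        (eventually_of_mem (hJ.mem_nhds hs) hc)).unique (h.hasDerivAt s hs)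
  have hC : C = 2 * K * c := by
    linarith [(hconst.hasDerivAt_deriv s hs).unique (hasDerivAt_const s 0)]
  rw [hC]
  have hsq := hconst.deriv_sq s hs
  rw [hC] at hsq
  linear_combination -K * hsq

theorem deriv_eq_zero_of_sq_eq (hC : C ^ 2 = 4 * K * (1 + b ^ 2)) (hs : s ∈ J) : u' s = 0 := by
  have hK : 0 ≤ K := nonneg_of_mul_nonneg_left (by linarith [sq_nonneg C] :
    0 ≤ K * (4 * (1 + b ^ 2))) (by positivity)
  have hsquares : K * u' s ^ 2 = -(C - 2 * K * u s) ^ 2 := by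
    linear_combination K * h.deriv_sq s hs + hC
  obtain rfl | hK := hK.eq_or_lt
  · have hC0 : C = 0 := by simpa using hC
    have := h.deriv_sq s hs
    rw [hC0] at this
    linarith [sq_nonneg (u' s), sq_nonneg b]
  · have : K * u' s ^ 2 = 0 := le_antisymm
      (hsquares.trans_le (neg_nonpos.2 (sq_nonneg _))) (by positivity)
    simpa [hK.ne'] using this

theorem exists_eq_const_iff (hJ : IsOpen J) (hJc : IsPreconnected J) (hne : J.Nonempty) :
    (∃ c, ∀ s ∈ J, u s = c) ↔ C ^ 2 = 4 * K * (1 + b ^ 2) :=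
  ⟨fun ⟨_, hc⟩ => h.sq_eq_of_eqOn_const hJ hne hc, fun hC => exists_eq_const_of_hasDerivAt_zero
    hJ hJc fun s hs => (h.hasDerivAt s hs).congr_deriv (h.deriv_eq_zero_of_sq_eq hC hs)⟩

end IsCurvatureRadius

end HalfEulerLagrange

section ProperHalfBiharmonic

variable {I : Set ℝ} {k τ : ℝ → ℝ} {K : ℝ}

theorem forall_eq_inv_of_forall_inv_eq_interior {u : ℝ → ℝ} (hI : I.OrdConnected)
    (hI' : (interior I).Nonempty) (hk : ContinuousOn k I) (hk0 : ∀ s ∈ I, k s ≠ 0)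
    (hu : Continuous u) (h : ∀ s ∈ interior I, (k s)⁻¹ = u s) : ∀ s ∈ I, k s = (u s)⁻¹ := by
  intro s hs
  have hEq : EqOn (fun s => (k s)⁻¹) u I := EqOn.of_subset_closure h (hk.inv₀ hk0)
    hu.continuousOn interior_subset (subset_closure_interior_of_ordConnected hI hI')
  rw [← hEq hs, inv_inv]

theorem exists_inv_eq_const_interior_iff (hI : I.OrdConnected) (hI' : (interior I).Nonempty)
    (hk : ContinuousOn k I) (hk0 : ∀ s ∈ I, k s ≠ 0) :
    (∃ c, ∀ s ∈ interior I, (k s)⁻¹ = c) ↔ ∀ s ∈ I, ∀ t ∈ I, k s = k t := by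
  constructor
  · rintro ⟨c, hc⟩ s hs t ht
    have hkc := forall_eq_inv_of_forall_inv_eq_interior hI hI' hk hk0 continuous_const hc
    rw [hkc s hs, hkc t ht]
  · intro h
    obtain ⟨t, ht⟩ := hI'
    exact ⟨(k t)⁻¹, fun s hs => by rw [h s (interior_subset hs) t (interior_subset ht)]⟩

variable {V : Type*} [NormedAddCommGroup V] [NormedSpace ℝ V] [FiniteDimensional ℝ V]
  {M : SpaceFormModel V} {γ N B : ℝ → V}

namespace IsFrenetFrame

variable (hM : M.IsSpaceForm) (hU : UniqueDiffOn ℝ I) (hγ : M.IsUnitSpeedCurve I γ)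
  (hF : M.IsFrenetFrame I γ k τ N B)

omit [FiniteDimensional ℝ V] in
include hF in
theorem tension_ne_zero {s : ℝ} (hs : s ∈ I) : M.tension I γ s ≠ 0 := fun h0 => by
  have hlen := hF.len_tension hs
  simp only [h0, len, map_zero, Real.sqrt_zero] at hlen
  exact (hF.k_pos s hs).ne hlen

include hM hU hγ hF

theorem isHalfBiharmonic_iff (hI : I.OrdConnected) : M.IsPBiharmonic (1 / 2) I γ ↔
    ∃ b C, (∀ s ∈ interior I, τ s = b * k s) ∧
      ∃ u', IsCurvatureRadius M.curv b C (interior I) (fun s => (k s)⁻¹) u' := by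
  have hk := (hF.smooth_curvature hM hU hγ).mono interior_subset
  have hτ := (hF.smooth_torsion hM hU hγ).mono interior_subset
  have hk0 : ∀ s ∈ interior I, 0 < k s := fun s hs => hF.k_pos s (interior_subset hs)
  have htangential : ∀ s ∈ interior I, 2 * deriv (fun s => k s ^ ((1 : ℝ) / 2 - 1)) s * k s +
      k s ^ ((1 : ℝ) / 2 - 1) * deriv k s = 0 := fun s hs => by
    rw [two_mul_deriv_rpow_mul_add
      (hasDerivAt_deriv_of_contDiffOn isOpen_interior hk hs).differentiableAt (hk0 s hs)]
    norm_num
  rw [hF.isPBiharmonic_iff hM hU hγ (by norm_num), ← eulerLagrange_half_eq_zero_iff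
    isOpen_interior hI.interior.isPreconnected hk hk0 hτ]
  exact forall₂_congr fun s hs => by simp only [htangential s hs, and_true]

theorem isProperHalfBiharmonic_iff (hI : I.OrdConnected) (hI' : (interior I).Nonempty) :
    M.IsProperHalfBiharmonic I γ ↔ ∃ b C, C ^ 2 ≠ 4 * M.curv * (1 + b ^ 2) ∧
      (∀ s ∈ I, τ s = b * k s) ∧
      ∃ u', IsCurvatureRadius M.curv b C (interior I) (fun s => (k s)⁻¹) u' := by
  have hk := hF.smooth_curvature hM hU hγ
  have hk0 : ∀ s ∈ I, k s ≠ 0 := fun s hs => (hF.k_pos s hs).ne'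
  have hne : (∃ s ∈ I, ∃ t ∈ I, M.len (M.tension I γ s) ≠ M.len (M.tension I γ t)) ↔
      ¬∃ c, ∀ s ∈ interior I, (k s)⁻¹ = c := by
    rw [exists_inv_eq_const_interior_iff hI hI' hk.continuousOn hk0]
    push Not
    refine exists_congr fun s => and_congr_right fun hs => exists_congr fun t =>
      and_congr_right fun ht => ?_
    rw [hF.len_tension hs, hF.len_tension ht]
  have hconst := fun {b C u'} (h : IsCurvatureRadius M.curv b C _ (fun s => (k s)⁻¹) u') =>
    h.exists_eq_const_iff isOpen_interior hI.interior.isPreconnected hI'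
  constructor
  · intro h
    obtain ⟨b, C, hb, u', hu⟩ := (hF.isHalfBiharmonic_iff hM hU hγ hI).1 h.biharmonic
    exact ⟨b, C, (hconst hu).not.1 (hne.1 h.nonconstant), EqOn.of_subset_closure hb
      (hF.smooth_torsion hM hU hγ).continuousOn (continuousOn_const.mul hk.continuousOn)
      interior_subset (subset_closure_interior_of_ordConnected hI hI'), u', hu⟩
  · rintro ⟨b, C, hC, hb, u', hu⟩
    exact ⟨fun s hs => hF.tension_ne_zero hs, (hF.isHalfBiharmonic_iff hM hU hγ hI).2
      ⟨b, C, fun s hs => hb s (interior_subset hs), u', hu⟩, hne.2 ((hconst hu).not.2 hC)⟩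

end IsFrenetFrame

end ProperHalfBiharmonic

section ExplicitSolutions

open Real

variable {b C : ℝ} {J : Set ℝ} {u u' : ℝ → ℝ}

namespace IsCurvatureRadius

theorem flat (hC : C ≠ 0) (b d : ℝ) : IsCurvatureRadius 0 b C J
    (fun s => (C ^ 2 * (s - d) ^ 2 + 1 + b ^ 2) / C) (fun s => 2 * C * (s - d)) := by
  have hshift : ∀ s : ℝ, HasDerivAt (fun s => s - d) 1 s := fun s => (hasDerivAt_id s).sub_const d
  refine ⟨fun s _ => ?_, fun s _ => ?_, fun s _ => ?_⟩
  · refine ((((((hshift s).fun_pow 2).const_mul (C ^ 2)).add_const 1).add_const (b ^ 2)).div_const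
      C).congr_deriv ?_
    push_cast
    field_simp
  · exact ((hshift s).const_mul (2 * C)).congr_deriv (by ring)
  · field_simp
    ring

theorem spherical {A : ℝ} (hA : A ^ 2 = C ^ 2 - 4 - 4 * b ^ 2) (d : ℝ) :
    IsCurvatureRadius 1 b C J (fun s => (C + A * sin (2 * (s + d))) / 2)
      (fun s => A * cos (2 * (s + d))) := by
  have hphase : ∀ s : ℝ, HasDerivAt (fun s => 2 * (s + d)) 2 s := fun s => by
    simpa using ((hasDerivAt_id s).add_const d).const_mul 2
  refine ⟨fun s _ => ?_, fun s _ => ?_, fun s _ => ?_⟩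
  · exact ((((hphase s).sin.const_mul A).const_add C).div_const 2).congr_deriv (by ring)
  · exact ((hphase s).cos.const_mul A).congr_deriv (by ring)
  · linear_combination A ^ 2 * sin_sq_add_cos_sq (2 * (s + d)) + hA

theorem hyperbolic (b C d : ℝ) : IsCurvatureRadius (-1) b C J
    (fun s => ((-C + exp (-2 * (d + s))) ^ 2 + 4 + 4 * b ^ 2) / (4 * exp (-2 * (d + s))))
    (fun s => ((C ^ 2 + 4 + 4 * b ^ 2) - exp (-2 * (d + s)) ^ 2) / (2 * exp (-2 * (d + s)))) := by
  have hexp : ∀ s, HasDerivAt (fun s => exp (-2 * (d + s))) (-2 * exp (-2 * (d + s))) s :=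
    fun s => by simpa [mul_comm] using (((hasDerivAt_id s).const_add d).const_mul (-2)).exp
  have hexp_sq := fun s => (hexp s).fun_pow 2
  refine ⟨fun s _ => ?_, fun s _ => ?_, fun s _ => ?_⟩
  · refine ((((((hexp s).const_add (-C)).fun_pow 2).add_const 4).add_const (4 * b ^ 2)).div
      ((hexp s).const_mul 4) (by positivity)).congr_deriv ?_
    field_simp
    ring
  · refine (((hexp_sq s).const_sub (C ^ 2 + 4 + 4 * b ^ 2)).div ((hexp s).const_mul 2)
      (by positivity)).congr_deriv ?_
    field_simp
    ring
  · field_simp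
    ring

theorem exists_eq_flat (h : IsCurvatureRadius 0 b C J u u') (hJ : IsOpen J)
    (hJc : IsPreconnected J) (hC : C ≠ 0) :
    ∃ d, ∀ s ∈ J, u s = (C ^ 2 * (s - d) ^ 2 + 1 + b ^ 2) / C := by
  obtain ⟨c, hc⟩ := exists_eq_const_of_hasDerivAt_zero hJ hJc (f := fun s => u' s - 2 * C * s)
    fun s hs => ((h.hasDerivAt_deriv s hs).sub ((hasDerivAt_id s).const_mul (2 * C))).congr_deriv
      (by ring)
  refine ⟨-c / (2 * C), fun s hs => ?_⟩
  have hu' : u' s = 2 * C * (s - -c / (2 * C)) := by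
    rw [← hc s hs]
    field_simp
    ring
  have hsq := h.deriv_sq s hs
  rw [hu'] at hsq
  rw [eq_div_iff hC]
  linarith

theorem exists_eq_cos_add_sin (h : IsCurvatureRadius 1 b C J u u') (hJ : IsOpen J)
    (hJc : IsPreconnected J) (hne : J.Nonempty) :
    ∃ p q : ℝ, 4 * (p ^ 2 + q ^ 2) = C ^ 2 - 4 - 4 * b ^ 2 ∧
      ∀ s ∈ J, u s = (C + 2 * (p * cos (2 * s) + q * sin (2 * s))) / 2 := by
  have hphase : ∀ s : ℝ, HasDerivAt (fun s : ℝ => 2 * s) 2 s := fun s => by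
    simpa using (hasDerivAt_id s).const_mul 2
  obtain ⟨p, hp⟩ := exists_eq_const_of_hasDerivAt_zero hJ hJc
    (f := fun s => (u s - C / 2) * cos (2 * s) - u' s / 2 * sin (2 * s))
    fun s hs => ((((h.hasDerivAt s hs).sub_const (C / 2)).mul (hphase s).cos).sub
      (((h.hasDerivAt_deriv s hs).div_const 2).mul (hphase s).sin)).congr_deriv (by ring)
  obtain ⟨q, hq⟩ := exists_eq_const_of_hasDerivAt_zero hJ hJc
    (f := fun s => (u s - C / 2) * sin (2 * s) + u' s / 2 * cos (2 * s))
    fun s hs => ((((h.hasDerivAt s hs).sub_const (C / 2)).mul (hphase s).sin).add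
      (((h.hasDerivAt_deriv s hs).div_const 2).mul (hphase s).cos)).congr_deriv (by ring)
  refine ⟨p, q, ?_, fun s hs => ?_⟩
  · obtain ⟨s, hs⟩ := hne
    rw [← hp s hs, ← hq s hs]
    linear_combination (4 * (u s - C / 2) ^ 2 + u' s ^ 2) * sin_sq_add_cos_sq (2 * s) +
      h.deriv_sq s hs
  · rw [← hp s hs, ← hq s hs]
    linear_combination -(u s - C / 2) * sin_sq_add_cos_sq (2 * s)

theorem exists_eq_spherical (h : IsCurvatureRadius 1 b C J u u') (hJ : IsOpen J)
    (hJc : IsPreconnected J) (hne : J.Nonempty) : 4 + 4 * b ^ 2 ≤ C ^ 2 ∧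
    ∃ d, ∀ s ∈ J, u s = (C + √(C ^ 2 - 4 - 4 * b ^ 2) * sin (2 * (s + d))) / 2 := by
  obtain ⟨p, q, hpq, hu⟩ := h.exists_eq_cos_add_sin hJ hJc hne
  obtain ⟨d, hd⟩ := exists_sqrt_mul_sin_add_eq p q
  have hsqrt : √(C ^ 2 - 4 - 4 * b ^ 2) = 2 * √(p ^ 2 + q ^ 2) := by
    rw [← hpq, sqrt_mul zero_le_four, show √4 = 2 by rw [sqrt_eq_iff_mul_self_eq] <;> norm_num]
  refine ⟨by linarith [sq_nonneg p, sq_nonneg q], d / 2, fun s hs => ?_⟩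
  rw [hu s hs, hd, hsqrt, mul_add, mul_div_cancel₀ d two_ne_zero, mul_assoc]

theorem two_mul_add_sub_deriv_pos (h : IsCurvatureRadius (-1) b C J u u')
    {s : ℝ} (hs : s ∈ J) (hu : 0 < u s) : 0 < 2 * u s + C - u' s := by
  have hprod : (2 * u s + C + u' s) * (2 * u s + C - u' s) = C ^ 2 + 4 * (1 + b ^ 2) := by
    linear_combination -h.deriv_sq s hs
  have hsum : 0 < u s + C := pos_of_mul_pos_left
    (by linarith [h.deriv_sq s hs, sq_nonneg (u' s), sq_nonneg b] : 0 < (u s + C) * u s) hu.le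
  have hpos : 0 < (2 * u s + C + u' s) * (2 * u s + C - u' s) := by
    rw [hprod]
    positivity
  by_contra! hneg
  linarith [neg_of_mul_pos_left hpos hneg]

theorem exists_eq_hyperbolic (h : IsCurvatureRadius (-1) b C J u u') (hJ : IsOpen J)
    (hJc : IsPreconnected J) (hne : J.Nonempty) (hu : ∀ s ∈ J, 0 < u s) :
    ∃ d, ∀ s ∈ J, u s = ((-C + exp (-2 * (d + s))) ^ 2 + 4 + 4 * b ^ 2) /
      (4 * exp (-2 * (d + s))) := by
  have hexp : ∀ s, HasDerivAt (fun s => exp (2 * s)) (exp (2 * s) * 2) s := fun s => by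
    simpa using ((hasDerivAt_id s).const_mul 2).exp
  obtain ⟨β, hβ⟩ := exists_eq_const_of_hasDerivAt_zero hJ hJc
    (f := fun s => (2 * u s + C - u' s) * exp (2 * s))
    fun s hs => (((((h.hasDerivAt s hs).const_mul 2).add_const C).sub
      (h.hasDerivAt_deriv s hs)).mul (hexp s)).congr_deriv (by simp only [Pi.sub_apply]; ring)
  have hβ0 : 0 < β := by
    obtain ⟨s, hs⟩ := hne
    rw [← hβ s hs]
    exact mul_pos (h.two_mul_add_sub_deriv_pos hs (hu s hs)) (exp_pos _)
  refine ⟨-log β / 2, fun s hs => ?_⟩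
  have hexp_eq : exp (-2 * (-log β / 2 + s)) = 2 * u s + C - u' s := by
    rw [show -2 * (-log β / 2 + s) = log β - 2 * s by ring, exp_sub, exp_log hβ0, ← hβ s hs,
      mul_div_cancel_right₀ _ (exp_pos _).ne']
  rw [eq_div_iff (by positivity), hexp_eq]
  linear_combination -h.deriv_sq s hs

end IsCurvatureRadius

end ExplicitSolutions

section Classification

open Real

variable {I : Set ℝ} {k τ : ℝ → ℝ} (hI : I.OrdConnected) (hI' : (interior I).Nonempty)
  (hk : ContinuousOn k I)

include hI hI' hk

theorem exists_isCurvatureRadius_zero_iff (hk0 : ∀ s ∈ I, k s ≠ 0) :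
    (∃ b C : ℝ, C ^ 2 ≠ 4 * 0 * (1 + b ^ 2) ∧ (∀ s ∈ I, τ s = b * k s) ∧
      ∃ u', IsCurvatureRadius 0 b C (interior I) (fun s => (k s)⁻¹) u') ↔
    ∃ b₁ b₄ b₅ : ℝ, ∀ s ∈ I,
      k s = b₄ / (b₄ ^ 2 * (s - b₅) ^ 2 + 1 + b₁ ^ 2) ∧ τ s = b₁ * k s := by
  constructor
  · rintro ⟨b, C, hC, hτ, u', hu⟩
    obtain ⟨d, hd⟩ := hu.exists_eq_flat isOpen_interior hI.interior.isPreconnected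
      (by simpa using hC)
    have hkI := forall_eq_inv_of_forall_inv_eq_interior hI hI' hk hk0
      (by fun_prop) hd
    exact ⟨b, C, d, fun s hs => ⟨by rw [hkI s hs, inv_div], hτ s hs⟩⟩
  · rintro ⟨b, C, d, h⟩
    have hC : C ≠ 0 := by
      rintro rfl
      obtain ⟨s, hs⟩ := hI'
      exact hk0 s (interior_subset hs) (by rw [(h s (interior_subset hs)).1, zero_div])
    refine ⟨b, C, by simpa using hC, fun s hs => (h s hs).2, _,
      (IsCurvatureRadius.flat hC b d).congr isOpen_interior (fun s hs => ?_) fun _ _ => rfl⟩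
    simp only [(h s (interior_subset hs)).1, inv_div]

theorem exists_isCurvatureRadius_one_iff (hk0 : ∀ s ∈ I, k s ≠ 0) :
    (∃ b C : ℝ, C ^ 2 ≠ 4 * 1 * (1 + b ^ 2) ∧ (∀ s ∈ I, τ s = b * k s) ∧
      ∃ u', IsCurvatureRadius 1 b C (interior I) (fun s => (k s)⁻¹) u') ↔
    ∃ b₁ b₂ b₃ : ℝ, 4 + 4 * b₁ ^ 2 < b₂ ^ 2 ∧ ∀ s ∈ I,
      k s = 2 / (b₂ + √(b₂ ^ 2 - 4 - 4 * b₁ ^ 2) * sin (2 * (s + b₃))) ∧ τ s = b₁ * k s := by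
  constructor
  · rintro ⟨b, C, hC, hτ, u', hu⟩
    obtain ⟨hle, d, hd⟩ := hu.exists_eq_spherical isOpen_interior hI.interior.isPreconnected hI'
    have hkI := forall_eq_inv_of_forall_inv_eq_interior hI hI' hk hk0 (by fun_prop) hd
    exact ⟨b, C, d, hle.lt_of_ne fun h => hC (by linarith), fun s hs =>
      ⟨by rw [hkI s hs, inv_div], hτ s hs⟩⟩
  · rintro ⟨b, C, d, hlt, h⟩
    have hsqrt : √(C ^ 2 - 4 - 4 * b ^ 2) ^ 2 = C ^ 2 - 4 - 4 * b ^ 2 := sq_sqrt (by linarith)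
    refine ⟨b, C, by linarith, fun s hs => (h s hs).2, _,
      (IsCurvatureRadius.spherical hsqrt d).congr isOpen_interior (fun s hs => ?_) fun _ _ => rfl⟩
    simp only [(h s (interior_subset hs)).1, inv_div]

theorem exists_isCurvatureRadius_neg_one_iff (hk0 : ∀ s ∈ I, 0 < k s) :
    (∃ b C : ℝ, C ^ 2 ≠ 4 * (-1) * (1 + b ^ 2) ∧ (∀ s ∈ I, τ s = b * k s) ∧
      ∃ u', IsCurvatureRadius (-1) b C (interior I) (fun s => (k s)⁻¹) u') ↔
    ∃ b₁ b₆ b₇ : ℝ, ∀ s ∈ I, k s = 4 * exp (-2 * (b₇ + s)) /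
      ((b₆ + exp (-2 * (b₇ + s))) ^ 2 + 4 + 4 * b₁ ^ 2) ∧ τ s = b₁ * k s := by
  constructor
  · rintro ⟨b, C, -, hτ, u', hu⟩
    obtain ⟨d, hd⟩ := hu.exists_eq_hyperbolic isOpen_interior hI.interior.isPreconnected hI'
      fun s hs => inv_pos.2 (hk0 s (interior_subset hs))
    have hcont : Continuous fun s => ((-C + exp (-2 * (d + s))) ^ 2 + 4 + 4 * b ^ 2) /
        (4 * exp (-2 * (d + s))) :=
      Continuous.div (by fun_prop) (by fun_prop) fun s => by positivity
    have hkI := forall_eq_inv_of_forall_inv_eq_interior hI hI' hk (fun s hs => (hk0 s hs).ne')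
      hcont hd
    exact ⟨b, -C, d, fun s hs => ⟨by rw [hkI s hs, inv_div], hτ s hs⟩⟩
  · rintro ⟨b, C, d, h⟩
    refine ⟨b, -C, by nlinarith, fun s hs => (h s hs).2, _,
      (IsCurvatureRadius.hyperbolic b (-C) d).congr isOpen_interior (fun s hs => ?_)
        fun _ _ => rfl⟩
    simp only [(h s (interior_subset hs)).1, inv_div, neg_neg]

end Classification

open scoped Matrix in
theorem isCrossProduct_euclidean3 :
    euclidean3.IsCrossProduct fun p => WithLp.toLp 2 (p.2.1.ofLp ⨯₃ p.2.2.ofLp) := by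
  have hform : ∀ x y, euclidean3.form x y = x.ofLp ⬝ᵥ y.ofLp := fun x y => by
    rw [dotProduct_comm]; rfl
  have hunit : ∀ {x v w}, euclidean3.IsOrthonormalPair x v w →
      v.ofLp ⨯₃ w.ofLp ⬝ᵥ v.ofLp ⨯₃ w.ofLp = 1 := fun {x v w} h => by
    rw [cross_dot_cross, dotProduct_comm w.ofLp v.ofLp, ← hform, ← hform, ← hform, h.unit_left,
      h.unit_right, h.orth]
    norm_num
  refine ⟨?_, fun _ => zero_mul _, hunit, fun _ => ?_, fun _ => ?_, ?_⟩
  · have hcoord : ∀ i j, ContDiff ℝ ∞ fun p : EuclideanSpace ℝ (Fin 3) × EuclideanSpace ℝ (Fin 3) ×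
        EuclideanSpace ℝ (Fin 3) => p.2.1 i * p.2.2 j - p.2.1 j * p.2.2 i := by fun_prop
    rw [contDiff_euclidean]
    intro i
    fin_cases i
    exacts [hcoord 1 2, hcoord 2 0, hcoord 0 1]
  · rw [hform, dot_self_cross]
  · rw [hform, dot_cross_self]
  · intro x v w h d _ hv hw hc
    rw [hform] at hv hw hc
    have hcross : v.ofLp ⨯₃ w.ofLp ⨯₃ d.ofLp = 0 := by
      rw [cross_cross_eq_smul_sub_smul, hv, hw, zero_smul, zero_smul, sub_zero]
    have hself := cross_dot_cross (v.ofLp ⨯₃ w.ofLp) d.ofLp (v.ofLp ⨯₃ w.ofLp) d.ofLp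
    rw [hcross, hc, hunit h, dotProduct_zero, zero_mul, one_mul, sub_zero] at hself
    exact WithLp.ofLp_injective 2 (dotProduct_self_eq_zero.1 hself.symm)

theorem isSpaceForm_euclidean3 : euclidean3.IsSpaceForm where
  symm x y := real_inner_comm y x
  curv_cases := .inl rfl
  curv_mul_form_self x _ := by simp [euclidean3]
  normalize_mem _ _ _ _ _ := mem_univ _
  pos _ _ _ _ hv := real_inner_self_pos.2 hv
  exists_isCrossProduct := ⟨_, isCrossProduct_euclidean3⟩

/-- A space form of curvature `K = ±1` inside the quadric `⟨x, x⟩ = K` of `ℝ⁴`, where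
`⟨x, y⟩ = K x₀y₀ + x₁y₁ + x₂y₂ + x₃y₃`. This treats `sphere3` and `hyperbolic3` simultaneously. -/
structure IsQuadric (M : SpaceFormModel (EuclideanSpace ℝ (Fin 4))) : Prop where
  curv_eq : M.curv = 1 ∨ M.curv = -1
  form_apply : ∀ x y, M.form x y = M.curv * (x 0 * y 0) + x 1 * y 1 + x 2 * y 2 + x 3 * y 3
  form_self : ∀ x ∈ M.carrier, M.form x x = M.curv

/-- The `3 × 3` minor of the matrix with rows `x`, `v`, `w` in the columns `i`, `j`, `k`. -/
noncomputable def minor (x v w : EuclideanSpace ℝ (Fin 4)) (i j k : Fin 4) : ℝ :=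
  Matrix.det !![x i, x j, x k; v i, v j, v k; w i, w j, w k]

/-- The vector product of three vectors of `ℝ⁴` for the form `K x₀y₀ + x₁y₁ + x₂y₂ + x₃y₃` with
`K = ±1`, normalized so that its product with `d` is the determinant of `d, x, v, w`. -/
noncomputable def tripleProduct (K : ℝ) (p : EuclideanSpace ℝ (Fin 4) × EuclideanSpace ℝ (Fin 4) ×
    EuclideanSpace ℝ (Fin 4)) : EuclideanSpace ℝ (Fin 4) :=
  !₂[K * minor p.1 p.2.1 p.2.2 1 2 3, -minor p.1 p.2.1 p.2.2 0 2 3, minor p.1 p.2.1 p.2.2 0 1 3,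
    -minor p.1 p.2.1 p.2.2 0 1 2]

theorem contDiff_tripleProduct (K : ℝ) {n : WithTop ℕ∞} : ContDiff ℝ n (tripleProduct K) := by
  have hminor : ∀ i j k, ContDiff ℝ n fun p : EuclideanSpace ℝ (Fin 4) × EuclideanSpace ℝ (Fin 4) ×
      EuclideanSpace ℝ (Fin 4) => minor p.1 p.2.1 p.2.2 i j k := fun i j k => by
    simp only [minor, Matrix.det_fin_three, Matrix.of_apply, Matrix.cons_val]
    fun_prop
  rw [contDiff_euclidean]
  intro i
  fin_cases i
  exacts [contDiff_const.mul (hminor 1 2 3), (hminor 0 2 3).neg, hminor 0 1 3, (hminor 0 1 2).neg]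

namespace IsQuadric

variable {M : SpaceFormModel (EuclideanSpace ℝ (Fin 4))} (hM : M.IsQuadric)
  {x v w d : EuclideanSpace ℝ (Fin 4)}

include hM

theorem curv_mul_self : M.curv * M.curv = 1 := by
  rcases hM.curv_eq with h | h <;> rw [h] <;> norm_num

theorem mem_tangentSpace_iff : v ∈ M.tangentSpace x ↔ M.form x v = 0 := by
  rw [mem_tangentSpace, mul_eq_zero]
  exact or_iff_right (left_ne_zero_of_mul_eq_one hM.curv_mul_self)

theorem symm (x y : EuclideanSpace ℝ (Fin 4)) : M.form x y = M.form y x := by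
  rw [hM.form_apply, hM.form_apply]
  ring

theorem form_tripleProduct : M.form d (tripleProduct M.curv (x, v, w)) =
    Matrix.det !![d 0, d 1, d 2, d 3; x 0, x 1, x 2, x 3; v 0, v 1, v 2, v 3;
      w 0, w 1, w 2, w 3] := by
  rw [hM.form_apply, Matrix.det_succ_row_zero]
  simp only [tripleProduct, minor, Fin.sum_univ_four, Matrix.det_fin_three, Fin.succAbove,
    Matrix.submatrix_apply, Matrix.of_apply, Matrix.cons_val, Fin.reduceSucc, Fin.reduceCastSucc,
    Fin.reduceLT, reduceIte, Fin.coe_ofNat_eq_mod]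
  rcases hM.curv_eq with h | h <;> rw [h] <;> ring

theorem form_tripleProduct_left : M.form x (tripleProduct M.curv (x, v, w)) = 0 := by
  rw [hM.form_tripleProduct]
  exact Matrix.det_zero_of_row_eq (i := 0) (j := 1) (by decide) rfl

theorem form_tripleProduct_middle : M.form v (tripleProduct M.curv (x, v, w)) = 0 := by
  rw [hM.form_tripleProduct]
  exact Matrix.det_zero_of_row_eq (i := 0) (j := 2) (by decide) rfl

theorem form_tripleProduct_right : M.form w (tripleProduct M.curv (x, v, w)) = 0 := by
  rw [hM.form_tripleProduct]
  exact Matrix.det_zero_of_row_eq (i := 0) (j := 3) (by decide) rfl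

theorem form_tripleProduct_self :
    M.form (tripleProduct M.curv (x, v, w)) (tripleProduct M.curv (x, v, w)) =
      M.curv * Matrix.det !![M.form x x, M.form x v, M.form x w; M.form v x, M.form v v, M.form v w;
        M.form w x, M.form w v, M.form w w] := by
  simp only [hM.form_apply, tripleProduct, minor, Matrix.det_fin_three, Matrix.of_apply,
    Matrix.cons_val]
  rcases hM.curv_eq with h | h <;> rw [h] <;> ring

open scoped Matrix in
theorem eq_zero_of_form_eq_zero
    (hne : M.form (tripleProduct M.curv (x, v, w)) (tripleProduct M.curv (x, v, w)) ≠ 0)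
    (hc : M.form (tripleProduct M.curv (x, v, w)) d = 0) (hx : M.form x d = 0)
    (hv : M.form v d = 0) (hw : M.form w d = 0) : d = 0 := by
  rw [hM.form_tripleProduct] at hne
  have hrow : ∀ y : EuclideanSpace ℝ (Fin 4), M.form y d = 0 →
      ![y 0, y 1, y 2, y 3] ⬝ᵥ ![M.curv * d 0, d 1, d 2, d 3] = 0 := fun y hy => by
    rw [← hy, hM.form_apply, dotProduct, Fin.sum_univ_four]
    simp only [Matrix.cons_val]
    ring
  have hker := Matrix.eq_zero_of_mulVec_eq_zero hne (v := ![M.curv * d 0, d 1, d 2, d 3]) (by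
    ext i
    fin_cases i
    exacts [hrow _ hc, hrow _ hx, hrow _ hv, hrow _ hw])
  ext i
  fin_cases i
  · exact (mul_eq_zero.1 (congrFun hker 0)).resolve_left
      (left_ne_zero_of_mul_eq_one hM.curv_mul_self)
  · exact congrFun hker 1
  · exact congrFun hker 2
  · exact congrFun hker 3

theorem isCrossProduct : M.IsCrossProduct (tripleProduct M.curv) := by
  have hunit : ∀ {x v w}, M.IsOrthonormalPair x v w →
      M.form (tripleProduct M.curv (x, v, w)) (tripleProduct M.curv (x, v, w)) = 1 := by
    intro x v w h
    have hv := hM.mem_tangentSpace_iff.1 h.mem_left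
    have hw := hM.mem_tangentSpace_iff.1 h.mem_right
    rw [hM.form_tripleProduct_self, hM.form_self x h.mem_carrier, hM.symm v x, hM.symm w x,
      hM.symm w v, hv, hw, h.unit_left, h.unit_right, h.orth, Matrix.det_fin_three]
    simpa using hM.curv_mul_self
  exact ⟨contDiff_tripleProduct _, fun _ => hM.mem_tangentSpace_iff.2 hM.form_tripleProduct_left,
    hunit, fun _ => hM.form_tripleProduct_middle, fun _ => hM.form_tripleProduct_right,
    fun h d hd hv hw hc => hM.eq_zero_of_form_eq_zero (by rw [hunit h]; exact one_ne_zero) hc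
      (hM.mem_tangentSpace_iff.1 hd) hv hw⟩

theorem form_add_self (hx : x ∈ M.carrier) (hv : v ∈ M.tangentSpace x) :
    M.form (x + v) (x + v) = M.curv * (1 + M.curv * M.form v v) := by
  simp only [map_add, LinearMap.add_apply, hM.form_self x hx, hM.symm v x,
    hM.mem_tangentSpace_iff.1 hv]
  linear_combination -M.form v v * hM.curv_mul_self

theorem form_normalize_self (hx : x ∈ M.carrier) (hv : v ∈ M.tangentSpace x)
    (hpos : 0 < 1 + M.curv * M.form v v) :
    M.form ((√(1 + M.curv * M.form v v))⁻¹ • (x + v)) ((√(1 + M.curv * M.form v v))⁻¹ • (x + v)) =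
      M.curv := by
  simp only [map_smul, LinearMap.smul_apply, smul_eq_mul, hM.form_add_self hx hv]
  have hsqrt := (Real.sqrt_pos.2 hpos).ne'
  field_simp
  rw [Real.sq_sqrt hpos.le]

theorem isSpaceForm
    (hnormalize : ∀ x ∈ M.carrier, ∀ v ∈ M.tangentSpace x, 0 < 1 + M.curv * M.form v v →
      (√(1 + M.curv * M.form v v))⁻¹ • (x + v) ∈ M.carrier)
    (hpos : ∀ x ∈ M.carrier, ∀ v ∈ M.tangentSpace x, v ≠ 0 → 0 < M.form v v) :
    M.IsSpaceForm where
  symm := hM.symm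
  curv_cases := .inr hM.curv_eq
  curv_mul_form_self x hx := by rw [hM.form_self x hx, sq]
  normalize_mem := hnormalize
  pos := hpos
  exists_isCrossProduct := ⟨_, hM.isCrossProduct⟩

end IsQuadric

theorem mem_carrier_sphere3_iff {x : EuclideanSpace ℝ (Fin 4)} :
    x ∈ sphere3.carrier ↔ sphere3.form x x = 1 := by
  rw [show sphere3.form x x = ‖x‖ ^ 2 from real_inner_self_eq_norm_sq x,
    pow_eq_one_iff_of_nonneg (norm_nonneg x) two_ne_zero]
  exact mem_sphere_zero_iff_norm

theorem isQuadric_sphere3 : sphere3.IsQuadric where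
  curv_eq := .inl rfl
  form_apply x y := by
    simp [sphere3, PiLp.inner_apply, Fin.sum_univ_four, mul_comm]
  form_self _ := mem_carrier_sphere3_iff.1

theorem isSpaceForm_sphere3 : sphere3.IsSpaceForm :=
  isQuadric_sphere3.isSpaceForm
    (fun _ hx _ hv hpos =>
      mem_carrier_sphere3_iff.2 (isQuadric_sphere3.form_normalize_self hx hv hpos))
    fun _ _ _ _ hv => real_inner_self_pos.2 hv

theorem isQuadric_hyperbolic3 : hyperbolic3.IsQuadric where
  curv_eq := .inr rfl
  form_apply x y := congrArg (fun r => r + x 1 * y 1 + x 2 * y 2 + x 3 * y 3) (neg_one_mul _).symm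
  form_self _ hx := hx.1

section Hyperbolic

variable {x v : EuclideanSpace ℝ (Fin 4)}

theorem sq_mul_hyperbolic3_form_self (hx : x ∈ hyperbolic3.carrier)
    (hv : v ∈ hyperbolic3.tangentSpace x) :
    x 0 ^ 2 * hyperbolic3.form v v = v 1 ^ 2 + v 2 ^ 2 + v 3 ^ 2 +
      ((x 1 * v 2 - x 2 * v 1) ^ 2 + (x 1 * v 3 - x 3 * v 1) ^ 2 +
        (x 2 * v 3 - x 3 * v 2) ^ 2) := by
  have hxx : lorentzForm x x = -1 := hx.1
  have hxv : lorentzForm x v = 0 := isQuadric_hyperbolic3.mem_tangentSpace_iff.1 hv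
  simp only [hyperbolic3, lorentzForm, LinearMap.mk₂_apply] at hxx hxv ⊢
  linear_combination (-(v 1 ^ 2 + v 2 ^ 2 + v 3 ^ 2)) * hxx +
    (x 0 * v 0 + (x 1 * v 1 + x 2 * v 2 + x 3 * v 3)) * hxv

theorem hyperbolic3_form_self_pos (hx : x ∈ hyperbolic3.carrier)
    (hv : v ∈ hyperbolic3.tangentSpace x) (hv0 : v ≠ 0) : 0 < hyperbolic3.form v v := by
  have hid := sq_mul_hyperbolic3_form_self hx hv
  by_contra! hle
  have hspace : v 1 ^ 2 + v 2 ^ 2 + v 3 ^ 2 ≤ 0 := by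
    linarith [mul_nonpos_of_nonneg_of_nonpos (sq_nonneg (x 0)) hle,
      sq_nonneg (x 1 * v 2 - x 2 * v 1), sq_nonneg (x 1 * v 3 - x 3 * v 1),
      sq_nonneg (x 2 * v 3 - x 3 * v 2)]
  have h1 : v 1 = 0 := by nlinarith only [hspace, sq_nonneg (v 2), sq_nonneg (v 3)]
  have h2 : v 2 = 0 := by nlinarith only [hspace, sq_nonneg (v 1), sq_nonneg (v 3)]
  have h3 : v 3 = 0 := by nlinarith only [hspace, sq_nonneg (v 1), sq_nonneg (v 2)]
  have h0 : v 0 = 0 := by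
    have hxv : lorentzForm x v = 0 := isQuadric_hyperbolic3.mem_tangentSpace_iff.1 hv
    simpa [lorentzForm, h1, h2, h3, hx.2.ne'] using hxv
  exact hv0 (by ext i; fin_cases i <;> assumption)

theorem add_apply_zero_pos (hx : x ∈ hyperbolic3.carrier) (hv : v ∈ hyperbolic3.tangentSpace x)
    (hlt : hyperbolic3.form v v < 1) : 0 < (x + v) 0 := by
  have hid := sq_mul_hyperbolic3_form_self hx hv
  have hspace : v 1 ^ 2 + v 2 ^ 2 + v 3 ^ 2 = v 0 ^ 2 + hyperbolic3.form v v := by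
    simp only [hyperbolic3, lorentzForm, LinearMap.mk₂_apply]
    ring
  have hsq : v 0 ^ 2 < x 0 ^ 2 := by
    have hxx : lorentzForm x x = -1 := hx.1
    simp only [lorentzForm, LinearMap.mk₂_apply] at hxx
    have hx0 : 0 ≤ x 0 ^ 2 - 1 := by
      linarith [sq_nonneg (x 1), sq_nonneg (x 2), sq_nonneg (x 3)]
    linarith [mul_le_of_le_one_left hx0 hlt.le, sq_nonneg (x 1 * v 2 - x 2 * v 1),
      sq_nonneg (x 1 * v 3 - x 3 * v 1), sq_nonneg (x 2 * v 3 - x 3 * v 2)]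
  rw [PiLp.add_apply]
  linarith [(abs_lt_of_sq_lt_sq' hsq hx.2.le).1]

theorem isSpaceForm_hyperbolic3 : hyperbolic3.IsSpaceForm :=
  isQuadric_hyperbolic3.isSpaceForm
    (fun x hx v hv hpos => ⟨isQuadric_hyperbolic3.form_normalize_self hx hv hpos,
      mul_pos (inv_pos.2 (Real.sqrt_pos.2 hpos)) (add_apply_zero_pos hx hv (by
        rw [show hyperbolic3.curv = -1 from rfl] at hpos
        linarith))⟩)
    fun _ hx _ hv hv0 => hyperbolic3_form_self_pos hx hv hv0

end Hyperbolic

end SpaceFormModel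

open SpaceFormModel

theorem mainTheorem2 (I : Set ℝ) (hI : I.OrdConnected) (hI' : (interior I).Nonempty) :
    (∀ γ : ℝ → EuclideanSpace ℝ (Fin 4), sphere3.IsUnitSpeedCurve I γ →
      (sphere3.IsProperHalfBiharmonic I γ →
        ∃ (k τ : ℝ → ℝ) (N B : ℝ → EuclideanSpace ℝ (Fin 4)),
          sphere3.IsFrenetFrame I γ k τ N B) ∧
      ∀ (k τ : ℝ → ℝ) (N B : ℝ → EuclideanSpace ℝ (Fin 4)),
        sphere3.IsFrenetFrame I γ k τ N B →
        (sphere3.IsProperHalfBiharmonic I γ ↔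
          ∃ b₁ b₂ b₃ : ℝ, 4 + 4 * b₁ ^ 2 < b₂ ^ 2 ∧ ∀ s ∈ I,
            k s = 2 / (b₂ + Real.sqrt (b₂ ^ 2 - 4 - 4 * b₁ ^ 2) * Real.sin (2 * (s + b₃))) ∧
            τ s = b₁ * k s)) ∧
    (∀ γ : ℝ → EuclideanSpace ℝ (Fin 3), euclidean3.IsUnitSpeedCurve I γ →
      (euclidean3.IsProperHalfBiharmonic I γ →
        ∃ (k τ : ℝ → ℝ) (N B : ℝ → EuclideanSpace ℝ (Fin 3)),
          euclidean3.IsFrenetFrame I γ k τ N B) ∧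
      ∀ (k τ : ℝ → ℝ) (N B : ℝ → EuclideanSpace ℝ (Fin 3)),
        euclidean3.IsFrenetFrame I γ k τ N B →
        (euclidean3.IsProperHalfBiharmonic I γ ↔
          ∃ b₁ b₄ b₅ : ℝ, ∀ s ∈ I,
            k s = b₄ / (b₄ ^ 2 * (s - b₅) ^ 2 + 1 + b₁ ^ 2) ∧
            τ s = b₁ * k s)) ∧
    (∀ γ : ℝ → EuclideanSpace ℝ (Fin 4), hyperbolic3.IsUnitSpeedCurve I γ →
      (hyperbolic3.IsProperHalfBiharmonic I γ →
        ∃ (k τ : ℝ → ℝ) (N B : ℝ → EuclideanSpace ℝ (Fin 4)),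
          hyperbolic3.IsFrenetFrame I γ k τ N B) ∧
      ∀ (k τ : ℝ → ℝ) (N B : ℝ → EuclideanSpace ℝ (Fin 4)),
        hyperbolic3.IsFrenetFrame I γ k τ N B →
        (hyperbolic3.IsProperHalfBiharmonic I γ ↔
          ∃ b₁ b₆ b₇ : ℝ, ∀ s ∈ I,
            k s = 4 * Real.exp (-2 * (b₇ + s)) /
              ((b₆ + Real.exp (-2 * (b₇ + s))) ^ 2 + 4 + 4 * b₁ ^ 2) ∧
            τ s = b₁ * k s)) := by
  have hU := uniqueDiffOn_convex hI.convex hI'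
  refine ⟨fun γ hγ => ⟨fun h => hγ.exists_isFrenetFrame isSpaceForm_sphere3 hU h.tension_ne_zero,
    fun k τ N B hF => ?_⟩, fun γ hγ => ⟨fun h => hγ.exists_isFrenetFrame isSpaceForm_euclidean3 hU
    h.tension_ne_zero, fun k τ N B hF => ?_⟩, fun γ hγ => ⟨fun h => hγ.exists_isFrenetFrame
    isSpaceForm_hyperbolic3 hU h.tension_ne_zero, fun k τ N B hF => ?_⟩⟩
  · exact (hF.isProperHalfBiharmonic_iff isSpaceForm_sphere3 hU hγ hI hI').trans
      (exists_isCurvatureRadius_one_iff hI hI'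
        (hF.smooth_curvature isSpaceForm_sphere3 hU hγ).continuousOn
        fun s hs => (hF.k_pos s hs).ne')
  · exact (hF.isProperHalfBiharmonic_iff isSpaceForm_euclidean3 hU hγ hI hI').trans
      (exists_isCurvatureRadius_zero_iff hI hI'
        (hF.smooth_curvature isSpaceForm_euclidean3 hU hγ).continuousOn
        fun s hs => (hF.k_pos s hs).ne')
  · exact (hF.isProperHalfBiharmonic_iff isSpaceForm_hyperbolic3 hU hγ hI hI').trans
      (exists_isCurvatureRadius_neg_one_iff hI hI'
        (hF.smooth_curvature isSpaceForm_hyperbolic3 hU hγ).continuousOn hF.k_pos)
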